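/- Let $1<\alpha\le 2$, and let $\mu_j>0$, $0<\gamma_j\le 2$ and $|\theta_j|\le\min(\gamma_j,2-\gamma_j)$ be real for $j=1,\dots,n$. For a function $u$ on $\mathbb R$ let $u^*(k)=\frac1{\sqrt{2\pi}}\int_{\mathbb R}e^{ikx}u(x)\,dx$ be its Fourier transform; more generally, an integrable $v$ is called the Fourier transform $u^*$ of $u$ if $u(x)=\frac1{\sqrt{2\pi}}\int_{\mathbb R}e^{-ikx}v(k)\,dk$ for all $x$. Let $$\Psi_\theta^\gamma(k)=|k|^\gamma e^{i\,\mathrm{sign}(k)\theta\pi/2},\qquad b(k)=\sum_{j=1}^n\mu_j\Psi_{\theta_j}^{\gamma_j}(k),\qquad E_{\alpha,\beta}(z)=\sum_{m\ge0}\frac{z^m}{\Gamma(\alpha m+\beta)}.$$ The Riesz--Feller derivative ${}_xD_\theta^\gamma$ is given by $({}_xD_\theta^\gamma u)^*=-\Psi_\theta^\gamma u^*$, with $u^*$ and $\Psi_\theta^\gamma u^*$ integrable. ${}_0D_t^\nu$ is the Riemann--Liouville derivative: ${}_0D_t^{\nu}=\frac{d^m}{dt^m}\,{}_0I_t^{m-\nu}$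 for $\nu>0$, $m-1<\nu\le m$, and ${}_0D_t^{\nu}={}_0I_t^{-\nu}$ for $\nu\le 0$, where ${}_0I_t^\nu y(t)=\frac1{\Gamma(\nu)}\int_0^t(t-u)^{\nu-1}y(u)\,du$ and ${}_0I_t^0y=y$. Let $f,g$ and $\phi(\cdot,t)$ $(t>0)$ be complex-valued, continuous and integrable on $\mathbb R$ with integrable Fourier transforms, and let $\phi^*(k,t)$ (the transform in $x$) be integrable on $\mathbb R\times(0,T]$ for every $T>0$. Consider the problem $${}_0D_t^\alpha N(x,t)=\sum_{j=1}^n\mu_j\,{}_xD_{\theta_j}^{\gamma_j}N(x,t)+\phi(x,t)\qquad(t>0,\ x\in\mathbb R),$$ $${}_0D_t^{\alpha-1}N(x,t)\big|_{t=0+}=f(x),\qquad {}_0D_t^{\alpha-2}N(x,t)\big|_{t=0+}=g(x),\qquad \lim_{x\to\pm\infty}N(x,t)=0\quad(t>0).$$ A solution is a function $N$ such that: $N(x,\cdot)$ is continuous on $(0,\infty)$ and integrable on each $(0,T]$ for all $x$; $N(\cdot,t)$ has a Fourier transform $N^*(k,t)$ for every $t>0$, continuous in $t>0$ for almost every $k$,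 with $(1+\sum_j|k|^{\gamma_j})N^*(k,t)$ integrable on each $\mathbb R\times(0,T]$; the time derivatives exist classically for $t>0$; and all the relations above hold at every point. Consider the formula $$N(x,t)=\frac{t^{\alpha-1}}{\sqrt{2\pi}}\int_{\mathbb R}e^{-ikx}E_{\alpha,\alpha}(-b(k)t^\alpha)f^*(k)\,dk+\frac{t^{\alpha-2}}{\sqrt{2\pi}}\int_{\mathbb R}e^{-ikx}E_{\alpha,\alpha-1}(-b(k)t^\alpha)g^*(k)\,dk$$ $$\qquad+\frac1{\sqrt{2\pi}}\int_0^t\xi^{\alpha-1}\int_{\mathbb R}E_{\alpha,\alpha}(-b(k)\xi^\alpha)e^{-ikx}\phi^*(k,t-\xi)\,dk\,d\xi.\qquad(*)$$ (i) If the integrals in $(*)$ (the last one as a double integral) converge absolutely for every $t>0$, then every solution $N$ is given by $(*)$ for all $x\in\mathbb R$, $t>0$. (ii) Suppose that $\phi^*(k,\cdot)$ is continuous on $(0,\infty)$ for almost every $k$, and that for every $T>0$ there is an integrable $G$ on $\mathbb R$ that bounds, for almost every $k$ and all $s,t\in(0,T]$, each of $|E_{\alpha,\alpha}(-b(k)t^\alpha)f^*(k)|$,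 $|E_{\alpha,\alpha-1}(-b(k)t^\alpha)g^*(k)|$ and $|E_{\alpha,\alpha}(-b(k)t^\alpha)\phi^*(k,s)|$ multiplied by $1+\sum_j|k|^{\gamma_j}$. Then the function $(*)$ is a solution. -/

import Mathlib

open MeasureTheory Set Filter Topology

noncomputable section

namespace ReactionDiffusion

/-! ### Special functions and transforms -/

/-- The Mittag-Leffler function `E_{α,β}(z) = ∑ₙ zⁿ / Γ(nα + β)`. -/
def mittagLeffler (α β : ℝ) (z : ℂ) : ℂ :=
  ∑' n : ℕ, z ^ n / (Real.Gamma (n * α + β) : ℂ)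

/-- The Fourier transform `u*(k) = (2π)^{-1/2} ∫ e^{ikx} u(x) dx`. -/
def fourierT (u : ℝ → ℂ) (k : ℝ) : ℂ :=
  ((√(2 * Real.pi))⁻¹ : ℂ) * ∫ x : ℝ, Complex.exp (Complex.I * k * x) * u x

/-- The inverse Fourier transform `(2π)^{-1/2} ∫ e^{-ikx} v(k) dk`. -/
def invFourierT (v : ℝ → ℂ) (x : ℝ) : ℂ :=
  ((√(2 * Real.pi))⁻¹ : ℂ) * ∫ k : ℝ, Complex.exp (-(Complex.I * k * x)) * v k

/-- The given functions of `x` are continuous and integrable, with integrable Fourier transform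
(the classical hypotheses of the Fourier inversion theorem). -/
structure FourierInvertible (u : ℝ → ℂ) : Prop where
  continuous : Continuous u
  integrable : Integrable u
  integrable_fourierT : Integrable (fourierT u)

/-- `v` is the (integrable) Fourier transform of `u`, where `u` itself need not be integrable:
`u` is the inverse Fourier integral of `v`, which determines `v` almost everywhere.
For an integrable `u`, `v` agrees almost everywhere with `fourierT u`. -/
def IsFourierTransform (u v : ℝ → ℂ) : Prop :=
  Integrable v ∧ ∀ x, u x = invFourierT v x

/-! ### Riemann-Liouville operators in time -/

/-- The Riemann-Liouville integral `₀I_t^ν y`, with `₀I_t^0 y = y`. -/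
def rlIntegral (ν : ℝ) (y : ℝ → ℂ) (t : ℝ) : ℂ :=
  if ν = 0 then y t
  else ((Real.Gamma ν)⁻¹ : ℂ) * ∫ u in (0 : ℝ)..t, (((t - u) ^ (ν - 1) : ℝ) : ℂ) * y u

/-- The Riemann-Liouville derivative `₀D_t^β y = d^m/dt^m (₀I_t^{m-β} y)` for `m - 1 < β ≤ m`;
for `β ≤ 0` one has `m = 0` and it is the integral `₀I_t^{-β} y`. -/
def rlDeriv (β : ℝ) (y : ℝ → ℂ) (t : ℝ) : ℂ :=
  iteratedDeriv ⌈β⌉₊ (rlIntegral (⌈β⌉₊ - β) y) t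

/-! ### Riesz-Feller operators in space -/

/-- `Ψ_θ^γ(k) = |k|^γ exp(i sign(k) θ π / 2)`. -/
def rfSymbol (γ θ k : ℝ) : ℂ :=
  ((|k| ^ γ : ℝ) : ℂ) * Complex.exp (Complex.I * Real.sign k * θ * Real.pi / 2)

/-- `h = ₓD_θ^γ u`: the Riesz-Feller derivative is the pseudo-differential operator with
`(ₓD_θ^γ u)*(k) = -Ψ_θ^γ(k) u*(k)`. -/
def HasRieszFellerDeriv (γ θ : ℝ) (u h : ℝ → ℂ) : Prop :=
  ∃ v : ℝ → ℂ, IsFourierTransform u v ∧ IsFourierTransform h (fun k => -rfSymbol γ θ k * v k)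

/-- `b(k) = ∑ⱼ μⱼ Ψ_{θⱼ}^{γⱼ}(k)`. -/
def bSymbol {n : ℕ} (μ γ θ : Fin n → ℝ) (k : ℝ) : ℂ :=
  ∑ j, (μ j : ℂ) * rfSymbol (γ j) (θ j) k

/-- The weight `1 + ∑ⱼ |k|^{γⱼ}`, which controls all the symbols `Ψ_{θⱼ}^{γⱼ}`. -/
def weight {n : ℕ} (γ : Fin n → ℝ) (k : ℝ) : ℝ :=
  1 + ∑ j, |k| ^ γ j

/-! ### The initial value problem -/

/-- The functions in which solutions are sought: `N(x, t)`, `t > 0`, is continuous in `t` and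
integrable near `t = 0`, and has for each `t > 0` an integrable Fourier transform `V(k, t)` in `x`,
continuous in `t`, such that `(1 + ∑ⱼ |k|^{γⱼ}) V(k, t)` is integrable on each `ℝ × (0, T]`. -/
structure IsTransformable {n : ℕ} (γ : Fin n → ℝ) (N : ℝ → ℝ → ℂ) : Prop where
  continuousOn : ∀ x, ContinuousOn (N x) (Ioi 0)
  integrableOn : ∀ x, ∀ T > 0, IntegrableOn (N x) (Ioc 0 T)
  exists_transform : ∃ V : ℝ → ℝ → ℂ,
    (∀ t > 0, IsFourierTransform (fun x => N x t) (fun k => V k t)) ∧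
    (∀ᵐ k : ℝ, ContinuousOn (V k) (Ioi 0)) ∧
    ∀ T > 0, IntegrableOn (fun p : ℝ × ℝ => (weight γ p.1 : ℂ) * V p.1 p.2) (univ ×ˢ Ioc 0 T)

/-- `N` is a transformable solution of
`₀D_t^α N = ∑ⱼ μⱼ ₓD_{θⱼ}^{γⱼ} N + φ` for `t > 0`, `x ∈ ℝ`, with
`₀D_t^{α-1} N = f` and `₀D_t^{α-2} N = g` at `t = 0+`, and `N(x,t) → 0` as `x → ±∞`.
The derivatives in `t` exist in the classical sense at all `t > 0`. -/
structure IsSolution {n : ℕ} (α : ℝ) (μ γ θ : Fin n → ℝ) (f g : ℝ → ℂ) (φ : ℝ → ℝ → ℂ)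
    (N : ℝ → ℝ → ℂ) : Prop where
  transformable : IsTransformable γ N
  differentiableOn₂ : ∀ x, DifferentiableOn ℝ (rlDeriv (α - 2) (N x)) (Ioi 0)
  differentiableOn₁ : ∀ x, DifferentiableOn ℝ (rlDeriv (α - 1) (N x)) (Ioi 0)
  equation : ∃ D : Fin n → ℝ → ℝ → ℂ,
    (∀ j, ∀ t > 0, HasRieszFellerDeriv (γ j) (θ j) (fun x => N x t) (fun x => D j x t)) ∧
    ∀ x, ∀ t > 0, rlDeriv α (N x) t = ∑ j, (μ j : ℂ) * D j x t + φ x t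
  initial₁ : ∀ x, Tendsto (rlDeriv (α - 1) (N x)) (𝓝[>] 0) (𝓝 (f x))
  initial₂ : ∀ x, Tendsto (rlDeriv (α - 2) (N x)) (𝓝[>] 0) (𝓝 (g x))
  tendsto_atTop : ∀ t > 0, Tendsto (fun x => N x t) atTop (𝓝 0)
  tendsto_atBot : ∀ t > 0, Tendsto (fun x => N x t) atBot (𝓝 0)

/-- The Fourier transform `φ*(k, t)` of the source in the space variable. -/
def sourceT (φ : ℝ → ℝ → ℂ) (k t : ℝ) : ℂ :=
  fourierT (fun x => φ x t) k

/-- Regularity of the given functions: Fourier inversion holds in `x`, and `φ*` is integrable on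
each `ℝ × (0, T]`. -/
structure IsData (f g : ℝ → ℂ) (φ : ℝ → ℝ → ℂ) : Prop where
  f_inv : FourierInvertible f
  g_inv : FourierInvertible g
  φ_inv : ∀ t > 0, FourierInvertible (fun x => φ x t)
  φ_integrable : ∀ T > 0,
    IntegrableOn (fun p : ℝ × ℝ => sourceT φ p.1 p.2) (univ ×ˢ Ioc 0 T)

/-- The three integrals in the solution formula converge absolutely, for each `t > 0`. -/
structure FormulaConverges {n : ℕ} (α : ℝ) (μ γ θ : Fin n → ℝ) (f g : ℝ → ℂ)
    (φ : ℝ → ℝ → ℂ) : Prop where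
  f_term : ∀ t > 0, Integrable fun k : ℝ =>
    mittagLeffler α α (-bSymbol μ γ θ k * ((t ^ α : ℝ) : ℂ)) * fourierT f k
  g_term : ∀ t > 0, Integrable fun k : ℝ =>
    mittagLeffler α (α - 1) (-bSymbol μ γ θ k * ((t ^ α : ℝ) : ℂ)) * fourierT g k
  φ_term : ∀ t > 0, IntegrableOn (fun p : ℝ × ℝ =>
    ((p.2 ^ (α - 1) : ℝ) : ℂ) *
      mittagLeffler α α (-bSymbol μ γ θ p.1 * ((p.2 ^ α : ℝ) : ℂ)) * sourceT φ p.1 (t - p.2))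
    (univ ×ˢ Ioo 0 t)

/-- The integrals in the solution formula converge absolutely also after multiplication of the
integrands by the symbols `Ψ_{θⱼ}^{γⱼ}(k)`, uniformly for times in each `(0, T]`, and `φ*` is
continuous in time. -/
structure FormulaConvergesStrongly {n : ℕ} (α : ℝ) (μ γ θ : Fin n → ℝ) (f g : ℝ → ℂ)
    (φ : ℝ → ℝ → ℂ) : Prop where
  φ_continuous : ∀ᵐ k : ℝ, ContinuousOn (sourceT φ k) (Ioi 0)
  dominated : ∀ T > 0, ∃ G : ℝ → ℝ, Integrable G ∧ ∀ᵐ k : ℝ, ∀ t ∈ Ioc 0 T,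
    weight γ k * ‖mittagLeffler α α (-bSymbol μ γ θ k * ((t ^ α : ℝ) : ℂ)) * fourierT f k‖
      ≤ G k ∧
    weight γ k * ‖mittagLeffler α (α - 1) (-bSymbol μ γ θ k * ((t ^ α : ℝ) : ℂ)) * fourierT g k‖
      ≤ G k ∧
    ∀ s ∈ Ioc 0 T,
      weight γ k * ‖mittagLeffler α α (-bSymbol μ γ θ k * ((t ^ α : ℝ) : ℂ)) * sourceT φ k s‖
        ≤ G k

/-- The right-hand side of the solution formula. -/
def solutionFormula {n : ℕ} (α : ℝ) (μ γ θ : Fin n → ℝ) (f g : ℝ → ℂ) (φ : ℝ → ℝ → ℂ)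
    (x t : ℝ) : ℂ :=
  ((t ^ (α - 1) / √(2 * Real.pi) : ℝ) : ℂ) *
      (∫ k : ℝ, Complex.exp (-(Complex.I * k * x)) *
        mittagLeffler α α (-bSymbol μ γ θ k * ((t ^ α : ℝ) : ℂ)) * fourierT f k)
    + ((t ^ (α - 2) / √(2 * Real.pi) : ℝ) : ℂ) *
      (∫ k : ℝ, Complex.exp (-(Complex.I * k * x)) *
        mittagLeffler α (α - 1) (-bSymbol μ γ θ k * ((t ^ α : ℝ) : ℂ)) * fourierT g k)
    + ((√(2 * Real.pi))⁻¹ : ℂ) *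
      ∫ ξ in (0 : ℝ)..t, ((ξ ^ (α - 1) : ℝ) : ℂ) *
        ∫ k : ℝ, mittagLeffler α α (-bSymbol μ γ θ k * ((ξ ^ α : ℝ) : ℂ)) *
          Complex.exp (-(Complex.I * k * x)) * sourceT φ k (t - ξ)

end ReactionDiffusion

end

/-!
The problem is diagonalized by the Fourier transform in `x`. For a fixed frequency `k`, with
`b = b(k)`, it becomes the scalar equation `D^α v + b v = w` with data `a = f*(k)`, `c = g*(k)`
and source `w = φ*(k, ·)`. Put `P_ν(t) = t^{ν-1}/Γ(ν)` (`powerKernel`) and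
`e_β(t) = t^{β-1} E_{α,β}(-b t^α)` (`mlKernel`). Termwise integration and Euler's Beta integral
give `P_ν * e_β = e_{β+ν}` (`halfConv_powerKernel_mlKernel`), and splitting off the first term of
the series gives `e_β = P_β - b e_{β+α}` (`mlKernel_eq_sub`). With associativity of convolution on
the half-line these two rules do all the scalar work: `v = e_α a + e_{α-1} c + e_α * w`
(`modeSolution`) satisfies `I^ν v = P_{α-1+ν} c + P_{α+ν} a + P_{α+ν} * (w - b v)` for every
`ν ≥ 0` (`rlIntegral_modeSolution_eq`), and the case `ν = 1` of this equation determines `v`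
(`eq_modeSolution`), because convolution with `e_α` reduces its homogeneous version to
`P_{α+1} * v = 0`. The formula of the theorem is the inverse Fourier integral of `v`
(`solutionFormula_eq`).

For uniqueness (`eq_solutionFormula`), the equation of a solution `N` with transform `V` reads
`(I^{2-α} N)'' = Φ`, where `Φ(·, t)` is the inverse Fourier integral of `φ* - b V`. This function
is integrable up to `t = 0`, so that Taylor's formula with the initial conditions gives
`I^{2-α} N = g + t f + P_2 * Φ`. A further fractional integration, of order `α - 1`, removes the
singular kernel: `P_1 * N = P_α g + P_{α+1} f + P_{α+1} * Φ`. All time integrals now commute with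
the inverse Fourier integral, which is injective (`ae_eq_of_invFourierT`), so the scalar equation
holds for almost every `k`, at first for rational `t` and by continuity for all `t`.

For existence (`isSolution_solutionFormula`), the strong convergence bounds the transformed
solution, even multiplied by the symbols, by `t^{α-2} G(k)` on `(0, T]`
(`singularlyDominated_weight_mul`). Hence the scalar equation with `ν = 2 - α` may be transformed
back to `I^{2-α} N = g + t f + ∫₀ᵗ ∫₀ˢ Φ` with `Φ` continuous in `t > 0` and integrable near `0`;
the differential equation and both initial conditions can be read off. The decay in `x` is the
Riemann-Lebesgue lemma.
-/

namespace ReactionDiffusion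

noncomputable section

/-! ### Convolution on the half-line -/

/-- The convolution `∫₀ᵗ p (t - s) e s ds` of causal functions. -/
def halfConv (p e : ℝ → ℂ) (t : ℝ) : ℂ :=
  ∫ s in (0 : ℝ)..t, p (t - s) * e s

lemma halfConv_comm (p e : ℝ → ℂ) (t : ℝ) : halfConv p e t = halfConv e p t := by
  unfold halfConv
  have h := intervalIntegral.integral_comp_sub_left (a := 0) (b := t)
    (fun s => p (t - s) * e s) t
  simp only [sub_self, sub_zero, sub_sub_cancel] at h
  rw [← h]
  exact intervalIntegral.integral_congr fun s _ => mul_comm _ _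

lemma halfConv_congr {p p' e e' : ℝ → ℂ} {t : ℝ} (ht : 0 ≤ t)
    (hp : ∀ s, 0 < s → s ≤ t → p s = p' s) (he : ∀ s, 0 < s → s ≤ t → e s = e' s) :
    halfConv p e t = halfConv p' e' t := by
  unfold halfConv
  rw [intervalIntegral.integral_of_le ht, intervalIntegral.integral_of_le ht,
    integral_Ioc_eq_integral_Ioo, integral_Ioc_eq_integral_Ioo]
  refine setIntegral_congr_fun measurableSet_Ioo fun s hs => ?_
  rw [hp _ (sub_pos.2 hs.2) (by linarith [hs.1]), he s hs.1 hs.2.le]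

/-- Associativity, under the condition `|p| * |e| ≤ M` that makes Fubini's theorem applicable
for every integrable `w`. -/
lemma halfConv_assoc {p e w : ℝ → ℂ} {t M : ℝ} (ht : 0 < t) (hp : Measurable p)
    (he : Measurable e) (hw : IntegrableOn w (Ioc 0 t))
    (hint : ∀ τ ∈ Ioc 0 t, IntervalIntegrable (fun s => p (τ - s) * e s) volume 0 τ)
    (hM : ∀ τ ∈ Ioc 0 t, ∫ s in (0 : ℝ)..τ, ‖p (τ - s) * e s‖ ≤ M) :
    halfConv p (halfConv e w) t = halfConv (halfConv p e) w t := by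
  set ν := volume.restrict (Ioc (0 : ℝ) t) with hν
  let G : ℝ × ℝ → ℂ := fun z => {z : ℝ × ℝ | z.1 < z.2}.indicator
    (fun z => p (t - z.2) * e (z.2 - z.1) * w z.1) z
  have hGmeas : AEStronglyMeasurable G (ν.prod ν) := by
    refine AEStronglyMeasurable.indicator ?_ (measurableSet_lt measurable_fst measurable_snd)
    refine AEStronglyMeasurable.mul ?_ ?_
    · exact ((hp.comp (measurable_const.sub measurable_snd)).mul
        (he.comp (measurable_snd.sub measurable_fst))).aestronglyMeasurable
    · exact hw.aestronglyMeasurable.comp_fst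
  have hGsec : ∀ r s, G (r, s) =
      (Ioi r).indicator (fun s => p (t - s) * e (s - r) * w r) s := by
    intro r s
    simp only [G, indicator, mem_ofPred_eq, mem_Ioi]
  have hGsec' : ∀ r s, G (r, s) =
      (Iio s).indicator (fun r => p (t - s) * (e (s - r) * w r)) r := by
    intro r s
    simp only [G, indicator, mem_ofPred_eq, mem_Iio, mul_assoc]
  have hinter : ∀ r ∈ Ioc 0 t, Ioc 0 t ∩ Ioi r = Ioc r t := by
    intro r hr; ext s; simp only [mem_inter_iff, mem_Ioc, mem_Ioi]
    constructor
    · rintro ⟨⟨_, h⟩, h'⟩; exact ⟨h', h⟩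
    · rintro ⟨h, h'⟩; exact ⟨⟨hr.1.trans h, h'⟩, h⟩
  have hinter' : ∀ s ∈ Ioc 0 t, Ioc 0 t ∩ Iio s = Ioo 0 s := by
    intro r hr; ext s; simp only [mem_inter_iff, mem_Ioc, mem_Iio, mem_Ioo]
    constructor
    · rintro ⟨⟨h, _⟩, h'⟩; exact ⟨h, h'⟩
    · rintro ⟨h, h'⟩; exact ⟨⟨h, h'.le.trans hr.2⟩, h'⟩
  -- the inner integrals over `s ∈ (r, t)`, shifted to `(0, t - r)`
  have hshift : ∀ r, ∀ E : ℝ → ℝ → ℝ, ∫ s in r..t, E (t - s) (s - r) =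
      ∫ σ in (0 : ℝ)..(t - r), E (t - r - σ) σ := by
    intro r E
    have := intervalIntegral.integral_comp_sub_right (a := r) (b := t)
      (fun σ => E (t - r - σ) σ) r
    simp only [sub_self] at this
    rw [← this]
    refine intervalIntegral.integral_congr fun s _ => ?_
    congr 1; ring
  have hG : Integrable G (ν.prod ν) := by
    rw [integrable_prod_iff hGmeas]
    constructor
    · refine (ae_restrict_iff' measurableSet_Ioc).2 (Eventually.of_forall fun r hr => ?_)
      simp only [hGsec]
      rw [integrable_indicator_iff measurableSet_Ioi, IntegrableOn, hν,
        Measure.restrict_restrict measurableSet_Ioi, inter_comm, hinter r hr, ← IntegrableOn,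
        ← intervalIntegrable_iff_integrableOn_Ioc_of_le hr.2]
      refine IntervalIntegrable.mul_const ?_ _
      rcases hr.2.eq_or_lt with h | h
      · rw [h]
      have := (hint (t - r) ⟨by linarith, by linarith [hr.1]⟩).comp_sub_right r
      simp only [zero_add, sub_add_cancel] at this
      refine this.congr fun s _ => ?_
      congr 2; ring
    · have hb : Integrable (fun r => M * ‖w r‖) ν := hw.norm.const_mul M
      refine hb.mono' hGmeas.norm.integral_prod_right'
        ((ae_restrict_iff' measurableSet_Ioc).2 (Eventually.of_forall fun r hr => ?_))
      rw [Real.norm_of_nonneg (integral_nonneg fun _ => norm_nonneg _)]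
      simp only [hGsec, norm_indicator_eq_indicator_norm]
      rw [integral_indicator measurableSet_Ioi, hν,
        Measure.restrict_restrict measurableSet_Ioi, inter_comm, hinter r hr,
        ← intervalIntegral.integral_of_le hr.2]
      simp only [norm_mul]
      rw [intervalIntegral.integral_mul_const]
      refine mul_le_mul_of_nonneg_right ?_ (norm_nonneg _)
      rw [hshift r (fun a b => ‖p a‖ * ‖e b‖)]
      rcases hr.2.eq_or_lt with h | h
      · subst h
        simp only [sub_self, intervalIntegral.integral_same]
        refine le_trans ?_ (hM r hr)
        exact intervalIntegral.integral_nonneg hr.1.le fun _ _ => norm_nonneg _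
      · simpa only [norm_mul] using hM (t - r) ⟨by linarith, by linarith [hr.1]⟩
  have hswap := integral_integral_swap (f := fun r s => G (r, s)) hG
  have hl : ∫ s, ∫ r, G (r, s) ∂ν ∂ν = halfConv p (halfConv e w) t := by
    rw [halfConv, intervalIntegral.integral_of_le ht.le]
    refine setIntegral_congr_fun measurableSet_Ioc fun s hs => ?_
    simp only [hGsec']
    rw [integral_indicator measurableSet_Iio, hν,
      Measure.restrict_restrict measurableSet_Iio, inter_comm, hinter' s hs, integral_const_mul,
      halfConv, intervalIntegral.integral_of_le hs.1.le, integral_Ioc_eq_integral_Ioo]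
  have hr : ∫ r, ∫ s, G (r, s) ∂ν ∂ν = halfConv (halfConv p e) w t := by
    rw [halfConv, intervalIntegral.integral_of_le ht.le]
    refine setIntegral_congr_fun measurableSet_Ioc fun r hr => ?_
    simp only [hGsec]
    rw [integral_indicator measurableSet_Ioi, hν,
      Measure.restrict_restrict measurableSet_Ioi, inter_comm, hinter r hr, integral_mul_const,
      halfConv, ← intervalIntegral.integral_of_le hr.2]
    congr 1
    have := intervalIntegral.integral_comp_sub_right (a := r) (b := t)
      (fun σ => p (t - r - σ) * e σ) r
    simp only [sub_self] at this
    rw [← this]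
    refine intervalIntegral.integral_congr fun s _ => ?_
    congr 2; ring
  rw [← hl, ← hswap, hr]

lemma intervalIntegrable_comp_sub_left {p : ℝ → ℂ} {τ t : ℝ} (hτ : τ ∈ Ioc 0 t)
    (hp : IntegrableOn p (Ioc 0 t)) : IntervalIntegrable (fun s => p (τ - s)) volume 0 τ := by
  have h : IntervalIntegrable p volume 0 τ :=
    (intervalIntegrable_iff_integrableOn_Ioc_of_le hτ.1.le).2
      (hp.mono_set (Ioc_subset_Ioc_right hτ.2))
  have := h.comp_sub_left τ
  simp only [sub_zero, sub_self] at this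
  exact this.symm

lemma intervalIntegrable_halfConv {p e : ℝ → ℂ} {τ t C : ℝ} (hτ : τ ∈ Ioc 0 t)
    (hp : IntegrableOn p (Ioc 0 t)) (he : AEStronglyMeasurable e (volume.restrict (Ioc 0 t)))
    (hC : ∀ s ∈ Ioc 0 t, ‖e s‖ ≤ C) :
    IntervalIntegrable (fun s => p (τ - s) * e s) volume 0 τ := by
  have h := intervalIntegrable_comp_sub_left hτ hp
  rw [intervalIntegrable_iff_integrableOn_Ioc_of_le hτ.1.le] at h ⊢
  refine Integrable.mul_bdd (c := C) h
    (he.mono_measure (Measure.restrict_mono (Ioc_subset_Ioc_right hτ.2) le_rfl)) ?_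
  exact (ae_restrict_iff' measurableSet_Ioc).2
    (Eventually.of_forall fun s hs => hC s ⟨hs.1, hs.2.trans hτ.2⟩)

/-- Associativity of the convolution of an integrable, a bounded and an integrable function. -/
lemma halfConv_assoc_of_bounded {p e w : ℝ → ℂ} {t C : ℝ} (ht : 0 < t) (hp : Measurable p)
    (hpi : IntegrableOn p (Ioc 0 t)) (he : Measurable e) (hC : ∀ s ∈ Ioc 0 t, ‖e s‖ ≤ C)
    (hw : IntegrableOn w (Ioc 0 t)) :
    halfConv p (halfConv e w) t = halfConv (halfConv p e) w t := by
  have hi : ∀ τ ∈ Ioc 0 t, IntervalIntegrable (fun s => p (τ - s) * e s) volume 0 τ :=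
    fun τ hτ => intervalIntegrable_halfConv hτ hpi he.aestronglyMeasurable hC
  refine halfConv_assoc (M := C * ∫ s in Ioc 0 t, ‖p s‖) ht hp he hw hi fun τ hτ => ?_
  have hC0 : 0 ≤ C := (norm_nonneg _).trans (hC t ⟨ht, le_rfl⟩)
  calc ∫ s in (0 : ℝ)..τ, ‖p (τ - s) * e s‖
      ≤ ∫ s in (0 : ℝ)..τ, C * ‖p (τ - s)‖ := by
        refine intervalIntegral.integral_mono_on_of_le_Ioo hτ.1.le (hi τ hτ).norm
          ((intervalIntegrable_comp_sub_left hτ hpi).norm.const_mul C) fun s hs => ?_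
        rw [norm_mul, mul_comm]
        exact mul_le_mul_of_nonneg_right (hC s ⟨hs.1, hs.2.le.trans hτ.2⟩) (norm_nonneg _)
    _ = C * ∫ s in Ioc 0 τ, ‖p s‖ := by
        rw [intervalIntegral.integral_const_mul,
          intervalIntegral.integral_comp_sub_left (fun s => ‖p s‖) τ, sub_self, sub_zero,
          intervalIntegral.integral_of_le hτ.1.le]
    _ ≤ C * ∫ s in Ioc 0 t, ‖p s‖ := by
        refine mul_le_mul_of_nonneg_left ?_ hC0
        exact setIntegral_mono_set hpi.norm (Eventually.of_forall fun _ => norm_nonneg _)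
          (Ioc_subset_Ioc_right hτ.2).eventuallyLE

lemma halfConv_add_right {p e e' : ℝ → ℂ} {t : ℝ}
    (h : IntervalIntegrable (fun s => p (t - s) * e s) volume 0 t)
    (h' : IntervalIntegrable (fun s => p (t - s) * e' s) volume 0 t) :
    halfConv p (fun s => e s + e' s) t = halfConv p e t + halfConv p e' t := by
  unfold halfConv
  rw [← intervalIntegral.integral_add h h']
  exact intervalIntegral.integral_congr fun s _ => mul_add _ _ _

lemma halfConv_mul_const (p e : ℝ → ℂ) (c : ℂ) (t : ℝ) :
    halfConv p (fun s => e s * c) t = halfConv p e t * c := by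
  unfold halfConv
  rw [← intervalIntegral.integral_mul_const]
  exact intervalIntegral.integral_congr fun s _ => (mul_assoc _ _ _).symm

/-! ### Power kernels -/

/-- The kernel `t ^ (ν - 1) / Γ(ν)` of the Riemann-Liouville integral of order `ν`. -/
def powerKernel (ν t : ℝ) : ℂ :=
  ((t ^ (ν - 1) / Real.Gamma ν : ℝ) : ℂ)

lemma powerKernel_one (t : ℝ) : powerKernel 1 t = 1 := by simp [powerKernel]

lemma powerKernel_two (t : ℝ) : powerKernel 2 t = t := by
  norm_num [powerKernel]

lemma measurable_powerKernel (ν : ℝ) : Measurable (powerKernel ν) := by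
  unfold powerKernel; fun_prop

lemma norm_powerKernel {ν t : ℝ} (hν : 0 < ν) (ht : 0 ≤ t) :
    ‖powerKernel ν t‖ = t ^ (ν - 1) / Real.Gamma ν := by
  rw [powerKernel, Complex.norm_real, Real.norm_of_nonneg]
  have := Real.Gamma_pos_of_pos hν
  positivity

lemma continuous_powerKernel {ν : ℝ} (hν : 1 ≤ ν) : Continuous (powerKernel ν) := by
  unfold powerKernel
  have : Continuous fun t : ℝ => t ^ (ν - 1) := Real.continuous_rpow_const (by linarith)
  fun_prop

lemma integrableOn_rpow {ν t : ℝ} (hν : 0 < ν) (ht : 0 ≤ t) :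
    IntegrableOn (fun s : ℝ => s ^ (ν - 1)) (Ioc 0 t) :=
  (intervalIntegrable_iff_integrableOn_Ioc_of_le ht).1
    (intervalIntegral.intervalIntegrable_rpow' (by linarith))

lemma integrableOn_powerKernel {ν t : ℝ} (hν : 0 < ν) (ht : 0 ≤ t) :
    IntegrableOn (powerKernel ν) (Ioc 0 t) :=
  ((integrableOn_rpow hν ht).div_const _).ofReal

lemma rlIntegral_eq_halfConv {ν : ℝ} (hν : ν ≠ 0) (y : ℝ → ℂ) (t : ℝ) :
    rlIntegral ν y t = halfConv (powerKernel ν) y t := by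
  rw [rlIntegral, if_neg hν, halfConv, ← intervalIntegral.integral_const_mul]
  refine intervalIntegral.integral_congr fun s _ => ?_
  simp only [powerKernel]; push_cast; ring

lemma halfConv_powerKernel {ν η t : ℝ} (hν : 0 < ν) (hη : 0 < η) (ht : 0 < t) :
    halfConv (powerKernel ν) (powerKernel η) t = powerKernel (ν + η) t := by
  have hGν := Real.Gamma_pos_of_pos hν
  have hGη := Real.Gamma_pos_of_pos hη
  have hG := Real.Gamma_pos_of_pos (add_pos hν hη)
  have h1 : halfConv (powerKernel ν) (powerKernel η) t =
      ((Real.Gamma ν)⁻¹ * (Real.Gamma η)⁻¹ : ℝ) *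
        ∫ s in (0 : ℝ)..t, (s : ℂ) ^ ((η : ℂ) - 1) * ((t : ℂ) - s) ^ ((ν : ℂ) - 1) := by
    rw [halfConv, ← intervalIntegral.integral_const_mul, intervalIntegral.integral_of_le ht.le,
      intervalIntegral.integral_of_le ht.le]
    refine setIntegral_congr_fun measurableSet_Ioc fun s hs => ?_
    simp only [powerKernel]
    rw [Complex.ofReal_div, Complex.ofReal_div, Complex.ofReal_cpow (sub_nonneg.2 hs.2),
      Complex.ofReal_cpow hs.1.le]
    push_cast; ring
  rw [h1, Complex.betaIntegral_scaled _ _ ht, Complex.betaIntegral_eq_Gamma_mul_div _ _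
    (by simpa using hη) (by simpa using hν), ← Complex.ofReal_add, Complex.Gamma_ofReal,
    Complex.Gamma_ofReal, Complex.Gamma_ofReal, powerKernel, Complex.ofReal_div,
    Complex.ofReal_cpow ht.le, add_comm η ν]
  have e1 : (Real.Gamma ν : ℂ) ≠ 0 := by exact_mod_cast hGν.ne'
  have e2 : (Real.Gamma η : ℂ) ≠ 0 := by exact_mod_cast hGη.ne'
  have e3 : (Real.Gamma (ν + η) : ℂ) ≠ 0 := by exact_mod_cast hG.ne'
  push_cast
  field_simp

lemma powerKernel_ne_zero {ν t : ℝ} (hν : 0 < ν) (ht : 0 < t) : powerKernel ν t ≠ 0 := by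
  have := Real.Gamma_pos_of_pos hν
  rw [powerKernel]
  exact_mod_cast (by positivity : t ^ (ν - 1) / Real.Gamma ν ≠ 0)

lemma intervalIntegrable_powerKernel_mul {ν η t : ℝ} (hν : 0 < ν) (hη : 0 < η) (ht : 0 < t) :
    IntervalIntegrable (fun s => powerKernel ν (t - s) * powerKernel η s) volume 0 t := by
  -- the integral of a non-integrable function would be `0`
  apply intervalIntegral.intervalIntegrable_of_integral_ne_zero
  have := halfConv_powerKernel hν hη ht
  rw [halfConv] at this
  rw [this]
  exact powerKernel_ne_zero (add_pos hν hη) ht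

lemma integral_norm_powerKernel_mul {ν η t : ℝ} (hν : 0 < ν) (hη : 0 < η) (ht : 0 < t) :
    ∫ s in (0 : ℝ)..t, ‖powerKernel ν (t - s) * powerKernel η s‖ =
      t ^ (ν + η - 1) / Real.Gamma (ν + η) := by
  have h : ((∫ s in (0 : ℝ)..t, ‖powerKernel ν (t - s) * powerKernel η s‖ : ℝ) : ℂ) =
      powerKernel (ν + η) t := by
    rw [← halfConv_powerKernel hν hη ht, halfConv, ← intervalIntegral.integral_ofReal,
      intervalIntegral.integral_of_le ht.le, intervalIntegral.integral_of_le ht.le]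
    refine setIntegral_congr_fun measurableSet_Ioc fun s hs => ?_
    rw [norm_mul, norm_powerKernel hν (sub_nonneg.2 hs.2), norm_powerKernel hη hs.1.le,
      Complex.ofReal_mul, powerKernel, powerKernel]
  rw [powerKernel] at h
  exact Complex.ofReal_injective h

/-! ### The Mittag-Leffler function -/

lemma summable_mittagLeffler {α β : ℝ} (hα : 1 < α) (R : ℝ) :
    Summable fun n : ℕ => |R| ^ n / Real.Gamma (n * α + β) := by
  -- for `n ≥ m` the argument of `Γ` is at least `n + 1`, so that `Γ(nα + β) ≥ n!`
  obtain ⟨m, hm⟩ := exists_nat_gt ((1 - β) / (α - 1))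
  rw [div_lt_iff₀ (by linarith)] at hm
  refine summable_of_isBigO_nat (Real.summable_pow_div_factorial |R|) ?_
  refine Asymptotics.IsBigO.of_bound 1 ?_
  filter_upwards [eventually_ge_atTop (max m 1)] with n hn
  have h1 : 1 ≤ n := (le_max_right _ _).trans hn
  have h1' : (1 : ℝ) ≤ n := by exact_mod_cast h1
  have h2 : (m : ℝ) ≤ n := by exact_mod_cast (le_max_left _ _).trans hn
  have h3 : (n : ℝ) + 1 ≤ n * α + β := by nlinarith
  have h4 : (n.factorial : ℝ) ≤ Real.Gamma (n * α + β) := by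
    rw [← Real.Gamma_nat_eq_factorial]
    exact Real.Gamma_strictMonoOn_Ici.monotoneOn (by simp only [mem_Ici]; linarith)
      (by simp only [mem_Ici]; linarith) h3
  have h5 : (0 : ℝ) < n.factorial := by positivity
  have h6 := h5.trans_le h4
  rw [one_mul, Real.norm_of_nonneg (by positivity), Real.norm_of_nonneg (by positivity)]
  gcongr

lemma norm_mittagLeffler_term {α β : ℝ} (hα : 1 < α) (hβ : 0 < β) (z : ℂ) (n : ℕ) :
    ‖z ^ n / (Real.Gamma (n * α + β) : ℂ)‖ = ‖z‖ ^ n / Real.Gamma (n * α + β) := by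
  have : 0 < Real.Gamma (n * α + β) := Real.Gamma_pos_of_pos (by positivity)
  rw [norm_div, norm_pow, Complex.norm_real, Real.norm_of_nonneg this.le]

lemma hasSum_mittagLeffler {α β : ℝ} (hα : 1 < α) (hβ : 0 < β) (z : ℂ) :
    HasSum (fun n : ℕ => z ^ n / (Real.Gamma (n * α + β) : ℂ)) (mittagLeffler α β z) := by
  refine (Summable.of_norm ?_).hasSum
  simp only [norm_mittagLeffler_term hα hβ]
  simpa using summable_mittagLeffler (β := β) hα ‖z‖

lemma continuous_mittagLeffler {α β : ℝ} (hα : 1 < α) (hβ : 0 < β) :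
    Continuous (mittagLeffler α β) := by
  rw [continuous_iff_continuousAt]
  intro z
  have h : ContinuousOn (mittagLeffler α β) (Metric.ball 0 (‖z‖ + 1)) := by
    refine continuousOn_tsum (u := fun n : ℕ => |‖z‖ + 1| ^ n / Real.Gamma (n * α + β))
      (fun n => by fun_prop) (summable_mittagLeffler hα _) fun n w hw => ?_
    rw [norm_mittagLeffler_term hα hβ, abs_of_nonneg (by positivity)]
    have : 0 < Real.Gamma (n * α + β) := Real.Gamma_pos_of_pos (by positivity)
    rw [mem_ball_zero_iff] at hw
    gcongr
  exact h.continuousAt (Metric.isOpen_ball.mem_nhds (by simp))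

lemma mittagLeffler_zero (α β : ℝ) : mittagLeffler α β 0 = (Real.Gamma β : ℂ)⁻¹ := by
  rw [mittagLeffler, tsum_eq_single 0 (fun n hn => by simp [hn])]
  simp

/-- The kernel `t ^ (β - 1) E_{α,β}(-b t ^ α)`. -/
def mlKernel (α β : ℝ) (b : ℂ) (t : ℝ) : ℂ :=
  ((t ^ (β - 1) : ℝ) : ℂ) * mittagLeffler α β (-b * ((t ^ α : ℝ) : ℂ))

lemma measurable_mlKernel {α β : ℝ} (hα : 1 < α) (hβ : 0 < β) {X : Type*} [MeasurableSpace X]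
    {b : X → ℂ} {τ : X → ℝ} (hb : Measurable b) (hτ : Measurable τ) :
    Measurable fun x => mlKernel α β (b x) (τ x) := by
  unfold mlKernel
  have := (continuous_mittagLeffler hα hβ).measurable
  refine Measurable.mul (by fun_prop) (this.comp ?_)
  fun_prop

lemma continuous_mlKernel {α β : ℝ} (hα : 1 < α) (hβ : 1 ≤ β) (b : ℂ) :
    Continuous (mlKernel α β b) := by
  unfold mlKernel
  have h1 : Continuous fun t : ℝ => t ^ (β - 1) := Real.continuous_rpow_const (by linarith)
  have h2 : Continuous fun t : ℝ => t ^ α := Real.continuous_rpow_const (by linarith)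
  have := continuous_mittagLeffler (β := β) hα (by linarith)
  fun_prop

lemma continuousOn_mlKernel {α β : ℝ} (hα : 1 < α) (hβ : 0 < β) (b : ℂ) :
    ContinuousOn (mlKernel α β b) (Ioi 0) := by
  unfold mlKernel
  have h1 : ContinuousOn (fun t : ℝ => t ^ (β - 1)) (Ioi 0) := fun t ht =>
    (Real.continuousAt_rpow_const t _ (Or.inl (ne_of_gt ht))).continuousWithinAt
  have h2 : Continuous fun t : ℝ => t ^ α := Real.continuous_rpow_const (by linarith)
  have := continuous_mittagLeffler (β := β) hα hβ
  exact (Complex.continuous_ofReal.comp_continuousOn h1).mul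
    (this.comp (by fun_prop)).continuousOn

lemma exists_norm_mlKernel_le {α β : ℝ} (hα : 1 < α) (hβ : 0 < β) (b : ℂ) (T : ℝ) :
    ∃ C, ∀ t ∈ Ioc 0 T, ‖mlKernel α β b t‖ ≤ C * t ^ (β - 1) := by
  have h2 : Continuous fun t : ℝ => t ^ α := Real.continuous_rpow_const (by linarith)
  have h3 : Continuous fun t : ℝ => mittagLeffler α β (-b * ((t ^ α : ℝ) : ℂ)) :=
    (continuous_mittagLeffler hα hβ).comp (by fun_prop)
  obtain ⟨C, hC⟩ := (isCompact_Icc (a := (0 : ℝ)) (b := T)).exists_bound_of_continuousOn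
    h3.continuousOn
  refine ⟨C, fun t ht => ?_⟩
  rw [mlKernel, norm_mul, Complex.norm_real,
    Real.norm_of_nonneg (Real.rpow_nonneg ht.1.le _), mul_comm]
  exact mul_le_mul_of_nonneg_right (hC t ⟨ht.1.le, ht.2⟩) (Real.rpow_nonneg ht.1.le _)

lemma integrableOn_mlKernel {α β : ℝ} (hα : 1 < α) (hβ : 0 < β) (b : ℂ) {T : ℝ} (hT : 0 ≤ T) :
    IntegrableOn (mlKernel α β b) (Ioc 0 T) := by
  obtain ⟨C, hC⟩ := exists_norm_mlKernel_le hα hβ b T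
  exact ((integrableOn_rpow hβ hT).const_mul C).mono'
    (measurable_mlKernel hα hβ measurable_const measurable_id).aestronglyMeasurable
    ((ae_restrict_iff' measurableSet_Ioc).2 (Eventually.of_forall hC))

lemma hasSum_mlKernel {α β : ℝ} (hα : 1 < α) (hβ : 0 < β) (b : ℂ) {t : ℝ} (ht : 0 < t) :
    HasSum (fun n : ℕ => (-b) ^ n * powerKernel (n * α + β) t) (mlKernel α β b t) := by
  refine ((hasSum_mittagLeffler hα hβ (-b * ((t ^ α : ℝ) : ℂ))).mul_left
    (((t ^ (β - 1) : ℝ) : ℂ))).congr_fun ?_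
  intro n
  have : t ^ (n * α + β - 1) = t ^ (β - 1) * (t ^ α) ^ n := by
    rw [← Real.rpow_mul_natCast ht.le, ← Real.rpow_add ht]; congr 1; ring
  rw [powerKernel, this, mul_pow]
  push_cast
  ring

/-- `e_β = t^{β-1}/Γ(β) - b e_{β+α}`: separation of the first term of the series. -/
lemma mlKernel_eq_sub {α β : ℝ} (hα : 1 < α) (hβ : 0 < β) (b : ℂ) {t : ℝ} (ht : 0 < t) :
    mlKernel α β b t = powerKernel β t - b * mlKernel α (β + α) b t := by
  have h1 := hasSum_mlKernel hα hβ b ht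
  have h2 := (hasSum_mlKernel (β := β + α) hα (by linarith) b ht).mul_left (-b)
  have h3 : HasSum (fun n : ℕ => (-b) ^ (n + 1) * powerKernel ((n + 1 : ℕ) * α + β) t)
      (-b * mlKernel α (β + α) b t) := by
    refine h2.congr_fun fun n => ?_
    rw [pow_succ', mul_assoc]; congr 3; push_cast; ring
  have h4 := (hasSum_nat_add_iff' 1).2 h1
  have := h3.unique h4
  simp only [Finset.range_one, Finset.sum_singleton, pow_zero, one_mul, Nat.cast_zero, zero_mul,
    zero_add] at this
  linear_combination -this

/-- Fractional integration shifts the second index of the Mittag-Leffler kernel. -/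
lemma halfConv_powerKernel_mlKernel {α β ν : ℝ} (hα : 1 < α) (hβ : 0 < β) (hν : 0 < ν) (b : ℂ)
    {t : ℝ} (ht : 0 < t) :
    halfConv (powerKernel ν) (mlKernel α β b) t = mlKernel α (β + ν) b t := by
  have hpos : ∀ n : ℕ, 0 < n * α + β := fun n => by positivity
  let F : ℕ → ℝ → ℂ := fun n s =>
    (-b) ^ n * (powerKernel ν (t - s) * powerKernel (n * α + β) s)
  have hF : ∀ n, Integrable (F n) (volume.restrict (Ioc 0 t)) := fun n =>
    ((intervalIntegrable_iff_integrableOn_Ioc_of_le ht.le).1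
      (intervalIntegrable_powerKernel_mul hν (hpos n) ht)).const_mul _
  have hn : ∀ n, ∫ s in Ioc 0 t, ‖F n s‖ =
      t ^ (β + ν - 1) * (|‖b‖ * t ^ α| ^ n / Real.Gamma (n * α + (β + ν))) := by
    intro n
    simp only [F]
    have e : ∀ s, ‖(-b) ^ n * (powerKernel ν (t - s) * powerKernel (n * α + β) s)‖ =
      ‖b‖ ^ n * ‖powerKernel ν (t - s) * powerKernel (n * α + β) s‖ := by
      intro s; rw [norm_mul, norm_pow, norm_neg]
    simp only [e]
    rw [integral_const_mul, ← intervalIntegral.integral_of_le ht.le,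
      integral_norm_powerKernel_mul hν (hpos n) ht, abs_of_nonneg (by positivity), mul_pow,
      ← Real.rpow_mul_natCast ht.le, show ν + (n * α + β) - 1 = (β + ν - 1) + α * n by ring,
      Real.rpow_add ht, show ν + (n * α + β) = n * α + (β + ν) by ring]
    ring
  have hs : Summable fun n => ∫ s in Ioc 0 t, ‖F n s‖ := by
    simp only [hn]
    exact (summable_mittagLeffler hα _).mul_left _
  have h := hasSum_integral_of_summable_integral_norm hF hs
  have hl : ∫ s in Ioc 0 t, ∑' n, F n s = halfConv (powerKernel ν) (mlKernel α β b) t := by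
    rw [halfConv, intervalIntegral.integral_of_le ht.le]
    refine setIntegral_congr_fun measurableSet_Ioc fun s hs => ?_
    have := (hasSum_mlKernel hα hβ b hs.1).mul_left (powerKernel ν (t - s))
    rw [← this.tsum_eq]
    exact tsum_congr fun n => by simp only [F]; ring
  rw [hl] at h
  refine h.unique ((hasSum_mlKernel hα (by linarith : 0 < β + ν) b ht).congr_fun fun n => ?_)
  simp only [F]
  rw [integral_const_mul, ← intervalIntegral.integral_of_le ht.le]
  have := halfConv_powerKernel hν (hpos n) ht
  rw [halfConv] at this
  rw [this, show ν + (n * α + β) = n * α + (β + ν) by ring]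

/-! ### The Fourier transform on the line -/

section Fourier

open scoped FourierTransform SchwartzMap ContDiff

lemma invFourierT_eq_fourier (v : ℝ → ℂ) (x : ℝ) :
    invFourierT v x = ((√(2 * Real.pi))⁻¹ : ℂ) * 𝓕 v (x / (2 * Real.pi)) := by
  rw [invFourierT, Real.fourier_real_eq_integral_exp_smul]
  congr 2
  ext k
  rw [smul_eq_mul]
  congr 2
  push_cast
  have : (Real.pi : ℂ) ≠ 0 := by exact_mod_cast Real.pi_ne_zero
  field_simp

lemma fourierT_eq_fourierInv (u : ℝ → ℂ) (k : ℝ) :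
    fourierT u k = ((√(2 * Real.pi))⁻¹ : ℂ) * 𝓕⁻ u (k / (2 * Real.pi)) := by
  rw [fourierT, Real.fourierInv_eq_fourier_neg, Real.fourier_real_eq_integral_exp_smul]
  congr 2
  ext y
  rw [smul_eq_mul]
  congr 2
  push_cast
  have : (Real.pi : ℂ) ≠ 0 := by exact_mod_cast Real.pi_ne_zero
  field_simp

lemma continuous_fourierT {u : ℝ → ℂ} (hu : Integrable u) : Continuous (fourierT u) := by
  have h : Continuous (𝓕⁻ u) := by
    have : Continuous (𝓕 u) :=
      VectorFourier.fourierIntegral_continuous Real.continuous_fourierChar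
        (L := innerₗ ℝ) (by exact continuous_inner) hu
    have h2 : 𝓕⁻ u = fun w => 𝓕 u (-w) := by
      ext w; exact Real.fourierInv_eq_fourier_neg u w
    rw [h2]
    exact this.comp continuous_neg
  have h3 : fourierT u = fun k => ((√(2 * Real.pi))⁻¹ : ℂ) * 𝓕⁻ u (k / (2 * Real.pi)) := by
    ext k; exact fourierT_eq_fourierInv u k
  rw [h3]
  exact continuous_const.mul (h.comp (by fun_prop))

lemma FourierInvertible.isFourierTransform {u : ℝ → ℂ} (hu : FourierInvertible u) :
    IsFourierTransform u (fourierT u) := by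
  refine ⟨hu.integrable_fourierT, fun x => ?_⟩
  have hpi : (0 : ℝ) < 2 * Real.pi := by positivity
  set c : ℂ := ((√(2 * Real.pi))⁻¹ : ℂ) with hc
  have hc0 : c ≠ 0 := by
    rw [hc]; exact inv_ne_zero (by exact_mod_cast (Real.sqrt_pos.2 hpi).ne')
  have hc2 : c * c * ((2 * Real.pi : ℝ) : ℂ) = 1 := by
    have : ((√(2 * Real.pi) : ℝ) : ℂ) * ((√(2 * Real.pi) : ℝ) : ℂ) = ((2 * Real.pi : ℝ) : ℂ) := by
      exact_mod_cast Real.mul_self_sqrt hpi.le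
    rw [hc, ← this]
    have : ((√(2 * Real.pi) : ℝ) : ℂ) ≠ 0 := by exact_mod_cast (Real.sqrt_pos.2 hpi).ne'
    field_simp
  -- the transform in Mathlib's normalization is a dilation of `fourierT u`
  have hinv : 𝓕⁻ u = fun w => c⁻¹ * fourierT u (2 * Real.pi * w) := by
    ext w
    rw [fourierT_eq_fourierInv, mul_div_cancel_left₀ _ hpi.ne', ← hc, inv_mul_cancel_left₀ hc0]
  have hint : Integrable (𝓕⁻ u) := by
    rw [hinv]
    exact (hu.integrable_fourierT.comp_mul_left' hpi.ne').const_mul _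
  have hint' : Integrable (𝓕 u) := by
    have h2 : 𝓕 u = fun w => 𝓕⁻ u (-w) := by
      ext w; rw [Real.fourierInv_eq_fourier_neg, neg_neg]
    rw [h2]; exact hint.comp_neg
  have h := congrFun (hu.continuous.fourier_fourierInv_eq hu.integrable hint') x
  rw [← h, Real.fourier_real_eq_integral_exp_smul, invFourierT, hinv]
  have := Measure.integral_comp_mul_left
    (fun k : ℝ => Complex.exp (-(Complex.I * k * x)) * (c⁻¹ * fourierT u k)) (2 * Real.pi)
  have e : ∀ w : ℝ, Complex.exp (((-2 * Real.pi * w * x : ℝ) : ℂ) * Complex.I) •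
      (c⁻¹ * fourierT u (2 * Real.pi * w)) =
      Complex.exp (-(Complex.I * ((2 * Real.pi * w : ℝ) : ℂ) * x)) *
        (c⁻¹ * fourierT u (2 * Real.pi * w)) := by
    intro w; rw [smul_eq_mul]; congr 2; push_cast; ring
  simp only [e]
  rw [this, abs_of_pos (inv_pos.2 hpi)]
  have e2 : ∀ k : ℝ, Complex.exp (-(Complex.I * k * x)) * (c⁻¹ * fourierT u k) =
      c⁻¹ * (Complex.exp (-(Complex.I * k * x)) * fourierT u k) := fun k => by ring
  simp only [e2]
  rw [integral_const_mul, Complex.real_smul, ← hc]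
  have h3 : c = c⁻¹ * ((2 * Real.pi : ℝ) : ℂ)⁻¹ := by
    rw [← mul_inv]
    exact eq_inv_of_mul_eq_one_left (by rw [← mul_assoc]; exact hc2)
  rw [Complex.ofReal_inv]
  set I := ∫ k : ℝ, Complex.exp (-(Complex.I * k * x)) * fourierT u k
  linear_combination -I * h3

lemma invFourierT_congr_ae {v w : ℝ → ℂ} (h : v =ᵐ[volume] w) (x : ℝ) :
    invFourierT v x = invFourierT w x := by
  unfold invFourierT
  congr 1
  refine integral_congr_ae ?_
  filter_upwards [h] with k hk
  rw [hk]

lemma norm_exp_mul (k x : ℝ) (z : ℂ) : ‖Complex.exp (-(Complex.I * k * x)) * z‖ = ‖z‖ := by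
  rw [norm_mul, show -(Complex.I * k * x) = ((-(k * x) : ℝ) : ℂ) * Complex.I by push_cast; ring,
    Complex.norm_exp_ofReal_mul_I, one_mul]

lemma integrable_exp_mul {X : Type*} [MeasurableSpace X] {m : Measure X} {v : X → ℂ}
    (hv : Integrable v m) {k : X → ℝ} (hk : Measurable k) (x : ℝ) :
    Integrable (fun z => Complex.exp (-(Complex.I * k z * x)) * v z) m := by
  refine hv.norm.mono' (AEStronglyMeasurable.mul ?_ hv.1)
    (Eventually.of_forall fun z => (norm_exp_mul _ _ _).le)
  exact (by fun_prop : Measurable fun z => Complex.exp (-(Complex.I * k z * x))).aestronglyMeasurable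

lemma invFourierT_add {v w : ℝ → ℂ} (hv : Integrable v) (hw : Integrable w) (x : ℝ) :
    invFourierT (fun k => v k + w k) x = invFourierT v x + invFourierT w x := by
  unfold invFourierT
  have := integral_add (integrable_exp_mul hv measurable_id x)
    (integrable_exp_mul hw measurable_id x)
  simp only [id] at this
  rw [← mul_add, ← this]
  simp only [mul_add]

lemma invFourierT_add_add {u v w : ℝ → ℂ} (hu : Integrable u) (hv : Integrable v)
    (hw : Integrable w) (x : ℝ) : invFourierT (fun k => u k + v k + w k) x =
      invFourierT u x + invFourierT v x + invFourierT w x := by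
  rw [← invFourierT_add hu hv]
  exact invFourierT_add (hu.add hv) hw x

lemma invFourierT_const_mul (c : ℂ) (v : ℝ → ℂ) (x : ℝ) :
    invFourierT (fun k => c * v k) x = c * invFourierT v x := by
  unfold invFourierT
  have : ∀ k : ℝ, Complex.exp (-(Complex.I * k * x)) * (c * v k) =
      c * (Complex.exp (-(Complex.I * k * x)) * v k) := fun k => mul_left_comm _ _ _
  simp only [this]
  rw [integral_const_mul, mul_left_comm]

lemma invFourierT_sub {v w : ℝ → ℂ} (hv : Integrable v) (hw : Integrable w) (x : ℝ) :
    invFourierT (fun k => v k - w k) x = invFourierT v x - invFourierT w x := by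
  have := invFourierT_add hv (hw.const_mul (-1)) x
  rw [invFourierT_const_mul] at this
  rw [sub_eq_add_neg, ← neg_one_mul, ← this]
  congr 1; ext k; ring

lemma invFourierT_sum {ι : Type*} (s : Finset ι) {v : ι → ℝ → ℂ}
    (hv : ∀ i ∈ s, Integrable (v i)) (x : ℝ) :
    invFourierT (fun k => ∑ i ∈ s, v i k) x = ∑ i ∈ s, invFourierT (v i) x := by
  unfold invFourierT
  have := integral_finsetSum s fun i hi => integrable_exp_mul (hv i hi) measurable_id x
  simp only [id] at this
  rw [← Finset.mul_sum, ← this]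
  simp only [Finset.mul_sum]

/-- Injectivity of the inverse Fourier integral on integrable functions: the function annihilates
all Schwartz functions, since each of these is a Fourier transform. -/
lemma ae_eq_zero_of_invFourierT {v : ℝ → ℂ} (hv : Integrable v)
    (h : ∀ x, invFourierT v x = 0) : v =ᵐ[volume] 0 := by
  have hpi : (0 : ℝ) < 2 * Real.pi := by positivity
  have h0 : ∀ w, 𝓕 v w = 0 := by
    intro w
    have := h (2 * Real.pi * w)
    rw [invFourierT_eq_fourier, mul_div_cancel_left₀ _ hpi.ne'] at this
    refine (mul_eq_zero.1 this).resolve_left (inv_ne_zero ?_)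
    exact_mod_cast (Real.sqrt_pos.2 hpi).ne'
  refine ae_eq_zero_of_integral_contDiff_smul_eq_zero hv.locallyIntegrable fun g hg hgc => ?_
  have hgc' : HasCompactSupport fun x => (g x : ℂ) := hgc.comp_left (g := Complex.ofReal) rfl
  let ψ : 𝓢(ℝ, ℂ) := hgc'.toSchwartzMap (Complex.ofRealCLM.contDiff.comp hg)
  have hψ : ∀ x, (g x : ℂ) = 𝓕 (𝓕⁻ ψ : 𝓢(ℝ, ℂ)) x := by
    intro x
    rw [FourierTransform.fourier_fourierInv_eq]
    rfl
  have hflip := VectorFourier.integral_fourierIntegral_smul_eq_flip (L := innerₗ ℝ)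
    Real.continuous_fourierChar (by exact continuous_inner) hv ((𝓕⁻ ψ : 𝓢(ℝ, ℂ)).integrable (μ := volume))
  have hl : ∀ w, VectorFourier.fourierIntegral Real.fourierChar volume (innerₗ ℝ) v w = 0 := h0
  simp only [hl, zero_smul, integral_zero] at hflip
  rw [hflip]
  refine integral_congr_ae (Eventually.of_forall fun x => ?_)
  simp only [Complex.real_smul, hψ x, smul_eq_mul]
  rw [mul_comm, SchwartzMap.fourier_coe, flip_innerₗ]
  rfl

lemma ae_eq_of_invFourierT {v w : ℝ → ℂ} (hv : Integrable v) (hw : Integrable w)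
    (h : ∀ x, invFourierT v x = invFourierT w x) : v =ᵐ[volume] w := by
  have := ae_eq_zero_of_invFourierT (hv.sub hw) fun x => by
    have := invFourierT_sub hv hw x
    rw [h, sub_self] at this
    exact this
  filter_upwards [this] with k hk
  exact sub_eq_zero.1 hk

/-- The Riemann-Lebesgue lemma. -/
lemma tendsto_invFourierT (v : ℝ → ℂ) : Tendsto (invFourierT v) (cocompact ℝ) (𝓝 0) := by
  have hpi : (2 * Real.pi) ≠ 0 := by positivity
  have h := (Real.zero_at_infty_fourier v).comp
    ((Homeomorph.mulRight₀ _ (inv_ne_zero hpi)).isClosedEmbedding.tendsto_cocompact)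
  have h2 := h.const_mul ((√(2 * Real.pi))⁻¹ : ℂ)
  rw [mul_zero] at h2
  refine h2.congr fun x => ?_
  rw [invFourierT_eq_fourier]
  rfl

end Fourier

/-! ### Functions on slabs `ℝ × (0, t]` -/

lemma volume_restrict_univ_prod (S : Set ℝ) :
    (volume : Measure (ℝ × ℝ)).restrict (univ ×ˢ S) = volume.prod (volume.restrict S) := by
  rw [Measure.volume_eq_prod, ← Measure.prod_restrict, Measure.restrict_univ]

lemma ae_slab_of_ae {S : Set ℝ} (hS : MeasurableSet S) {P : ℝ → ℝ → Prop}
    (h : ∀ᵐ k : ℝ, ∀ t ∈ S, P k t) :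
    ∀ᵐ p : ℝ × ℝ ∂(volume.restrict (univ ×ˢ S)), P p.1 p.2 := by
  rw [volume_restrict_univ_prod]
  have h1 : ∀ᵐ p : ℝ × ℝ ∂(volume.prod (volume.restrict S)), ∀ t ∈ S, P p.1 t :=
    Measure.quasiMeasurePreserving_fst.ae h
  have h2 : ∀ᵐ p : ℝ × ℝ ∂((volume : Measure ℝ).prod (volume.restrict S)), p.2 ∈ S :=
    Measure.quasiMeasurePreserving_snd.ae (ae_restrict_mem hS)
  filter_upwards [h1, h2] with p hp hp2 using hp _ hp2

/-- Time integration commutes with the inverse Fourier integral. -/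
lemma integral_invFourierT {H : ℝ → ℝ → ℂ} {t : ℝ} (ht : 0 ≤ t)
    (hH : IntegrableOn (fun p : ℝ × ℝ => H p.1 p.2) (univ ×ˢ Ioc 0 t)) (x : ℝ) :
    ∫ s in (0 : ℝ)..t, invFourierT (fun k => H k s) x =
      invFourierT (fun k => ∫ s in (0 : ℝ)..t, H k s) x := by
  unfold invFourierT
  rw [intervalIntegral.integral_const_mul, intervalIntegral.integral_of_le ht]
  rw [IntegrableOn, volume_restrict_univ_prod] at hH
  have := integral_integral_swap (f := fun (k s : ℝ) =>
    Complex.exp (-(Complex.I * k * x)) * H k s) (integrable_exp_mul hH measurable_fst x)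
  rw [← this]
  congr 2
  ext k
  simp only
  rw [integral_const_mul, intervalIntegral.integral_of_le ht]

lemma integrable_integral_slab {H : ℝ → ℝ → ℂ} {t : ℝ} (ht : 0 ≤ t)
    (hH : IntegrableOn (fun p : ℝ × ℝ => H p.1 p.2) (univ ×ˢ Ioc 0 t)) :
    Integrable fun k => ∫ s in (0 : ℝ)..t, H k s := by
  rw [IntegrableOn, volume_restrict_univ_prod] at hH
  simp only [intervalIntegral.integral_of_le ht]
  exact hH.integral_prod_left

lemma integrableOn_invFourierT {H : ℝ → ℝ → ℂ} {t : ℝ}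
    (hH : IntegrableOn (fun p : ℝ × ℝ => H p.1 p.2) (univ ×ˢ Ioc 0 t)) (x : ℝ) :
    IntegrableOn (fun s => invFourierT (fun k => H k s) x) (Ioc 0 t) := by
  rw [IntegrableOn, volume_restrict_univ_prod] at hH
  unfold invFourierT
  exact (integrable_exp_mul hH measurable_fst x).integral_prod_right.const_mul _

lemma ae_integrableOn_slab {H : ℝ → ℝ → ℂ}
    (hH : ∀ T > 0, IntegrableOn (fun p : ℝ × ℝ => H p.1 p.2) (univ ×ˢ Ioc 0 T)) :
    ∀ᵐ k : ℝ, ∀ T, IntegrableOn (H k) (Ioc 0 T) := by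
  have h : ∀ m : ℕ, ∀ᵐ k : ℝ, IntegrableOn (H k) (Ioc 0 ((m : ℝ) + 1)) := by
    intro m
    have := hH (m + 1) (by positivity)
    rw [IntegrableOn, volume_restrict_univ_prod] at this
    exact this.prod_right_ae
  filter_upwards [ae_all_iff.2 h] with k hk T
  obtain ⟨m, hm⟩ := exists_nat_gt T
  exact (hk m).mono_set (Ioc_subset_Ioc_right (by linarith))

/-! ### Continuity and uniqueness for convolution equations -/

lemma exists_norm_halfConv_le {e : ℝ → ℂ} (he : Continuous e) (T : ℝ) :
    ∃ C, 0 ≤ C ∧ ∀ w : ℝ → ℂ, IntegrableOn w (Ioc 0 T) → ∀ t ∈ Ioc 0 T,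
      ‖halfConv e w t‖ ≤ C * ∫ s in Ioc 0 T, ‖w s‖ := by
  obtain ⟨C, hC⟩ := (isCompact_Icc (a := (0 : ℝ)) (b := T)).exists_bound_of_continuousOn
    he.continuousOn
  refine ⟨max C 0, le_max_right _ _, fun w hw t ht => ?_⟩
  rw [halfConv, intervalIntegral.integral_of_le ht.1.le, ← integral_const_mul]
  refine (norm_integral_le_of_norm_le
    ((hw.mono_set (Ioc_subset_Ioc_right ht.2)).norm.const_mul (max C 0)) ?_).trans ?_
  · refine (ae_restrict_iff' measurableSet_Ioc).2 (Eventually.of_forall fun s hs => ?_)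
    rw [norm_mul]
    refine mul_le_mul_of_nonneg_right ((hC _ ⟨sub_nonneg.2 hs.2, ?_⟩).trans (le_max_left _ _))
      (norm_nonneg _)
    linarith [hs.1, ht.2]
  · refine setIntegral_mono_set (hw.norm.const_mul _) ?_
      (Ioc_subset_Ioc_right ht.2).eventuallyLE
    exact Eventually.of_forall fun s => mul_nonneg (le_max_right _ _) (norm_nonneg _)

lemma continuousOn_halfConv {e w : ℝ → ℂ} (he : Continuous e) (h0 : e 0 = 0)
    (hw : ∀ T, IntegrableOn w (Ioc 0 T)) : ContinuousOn (halfConv e w) (Ioi 0) := by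
  intro t₀ ht₀
  rw [mem_Ioi] at ht₀
  refine ContinuousAt.continuousWithinAt ?_
  set T := t₀ + 1
  obtain ⟨C, hC⟩ := (isCompact_Icc (a := (0 : ℝ)) (b := T)).exists_bound_of_continuousOn
    he.continuousOn
  have hev : ∀ᶠ t in 𝓝 t₀, t ∈ Ioo 0 T := Ioo_mem_nhds ht₀ (by simp [T])
  -- as `e 0 = 0`, the integral extends to the fixed interval `(0, T]`
  have heq : ∀ t ∈ Ioo 0 T, (∫ s in Ioc 0 T, e (max (t - s) 0) * w s) = halfConv e w t := by
    intro t ht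
    rw [halfConv, intervalIntegral.integral_of_le ht.1.le]
    have h1 : ∀ s ∈ Ioc 0 T \ Ioc 0 t, e (max (t - s) 0) * w s = 0 := by
      intro s hs
      have : t < s := by
        by_contra h
        exact hs.2 ⟨hs.1.1, not_lt.1 h⟩
      rw [max_eq_right (by linarith), h0, zero_mul]
    rw [setIntegral_eq_of_subset_of_forall_sdiff_eq_zero measurableSet_Ioc
      (Ioc_subset_Ioc_right ht.2.le) h1]
    refine setIntegral_congr_fun measurableSet_Ioc fun s hs => ?_
    rw [max_eq_left (sub_nonneg.2 hs.2)]
  have hc : ContinuousAt (fun t => ∫ s in Ioc 0 T, e (max (t - s) 0) * w s) t₀ := by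
    refine continuousAt_of_dominated (bound := fun s => C * ‖w s‖) ?_ ?_ ?_ ?_
    · refine Eventually.of_forall fun t => AEStronglyMeasurable.mul ?_ (hw T).aestronglyMeasurable
      exact (by fun_prop : Continuous fun s => e (max (t - s) 0)).aestronglyMeasurable
    · filter_upwards [hev] with t ht
      refine (ae_restrict_iff' measurableSet_Ioc).2 (Eventually.of_forall fun s hs => ?_)
      rw [norm_mul]
      refine mul_le_mul_of_nonneg_right (hC _ ⟨le_max_right _ _, max_le ?_ ?_⟩) (norm_nonneg _)
      · linarith [hs.1, ht.2]
      · linarith [ht.1, ht.2]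
    · exact (hw T).norm.const_mul C
    · refine Eventually.of_forall fun s => ?_
      exact (by fun_prop : Continuous fun t => e (max (t - s) 0) * w s).continuousAt
  refine hc.congr ?_
  filter_upwards [hev] with t ht using heq t ht

lemma halfConv_one (w : ℝ → ℂ) (t : ℝ) : halfConv (powerKernel 1) w t = ∫ s in (0 : ℝ)..t, w s := by
  simp [halfConv, powerKernel_one]

lemma intervalIntegrable_of_integrableOn {E : Type*} [NormedAddCommGroup E] {w : ℝ → E}
    (hw : ∀ T, IntegrableOn w (Ioc 0 T)) {t : ℝ}
    (ht : 0 ≤ t) : IntervalIntegrable w volume 0 t :=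
  (intervalIntegrable_iff_integrableOn_Ioc_of_le ht).2 (hw t)

lemma hasDerivAt_primitive {w : ℝ → ℂ} (hw : ∀ T, IntegrableOn w (Ioc 0 T))
    (hc : ContinuousOn w (Ioi 0)) {t : ℝ} (ht : 0 < t) :
    HasDerivAt (fun t => ∫ s in (0 : ℝ)..t, w s) (w t) t :=
  intervalIntegral.integral_hasDerivAt_right (intervalIntegrable_of_integrableOn hw ht.le)
    (hc.stronglyMeasurableAtFilter isOpen_Ioi t ht) (hc.continuousAt (Ioi_mem_nhds ht))

lemma tendsto_primitive {w : ℝ → ℂ} (hw : ∀ T, IntegrableOn w (Ioc 0 T)) :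
    Tendsto (fun t => ∫ s in (0 : ℝ)..t, w s) (𝓝[>] 0) (𝓝 0) := by
  have h : IntegrableOn w (Icc 0 1) := (integrableOn_Icc_iff_integrableOn_Ioc).2 (hw 1)
  have h2 := (intervalIntegral.continuousOn_primitive h) 0 (by simp)
  have h3 : Tendsto (fun x => ∫ t in Ioc 0 x, w t) (𝓝[Icc 0 1] 0) (𝓝 0) := by
    have := h2.tendsto
    simpa using this
  have h4 : 𝓝[>] (0 : ℝ) ≤ 𝓝[Icc 0 1] 0 := by
    rw [← nhdsWithin_Ioc_eq_nhdsGT (zero_lt_one' ℝ)]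
    exact nhdsWithin_mono _ Ioc_subset_Icc_self
  refine (h3.mono_left h4).congr' ?_
  filter_upwards [self_mem_nhdsWithin] with t ht
  rw [intervalIntegral.integral_of_le (le_of_lt ht)]

lemma intervalIntegrable_halfConv_of_continuous {e w : ℝ → ℂ} (he : Continuous e)
    {t : ℝ} (ht : 0 < t) (hw : IntegrableOn w (Ioc 0 t)) :
    IntervalIntegrable (fun s => e (t - s) * w s) volume 0 t :=
  ((intervalIntegrable_iff_integrableOn_Ioc_of_le ht.le).2 hw).continuousOn_mul
    (by fun_prop : Continuous fun s => e (t - s)).continuousOn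

lemma exists_bound_Ioc {e : ℝ → ℂ} (he : Continuous e) (t : ℝ) :
    ∃ C, ∀ s ∈ Ioc 0 t, ‖e s‖ ≤ C := by
  obtain ⟨C, hC⟩ := (isCompact_Icc (a := (0 : ℝ)) (b := t)).exists_bound_of_continuousOn
    he.continuousOn
  exact ⟨C, fun s hs => hC s ⟨hs.1.le, hs.2⟩⟩

/-- If `1 * u = -b (P * u)` with the power kernel `P` of order `α + 1`, then `u = 0`: convolution
with the resolvent kernel `t ^ (α - 1) E_{α,α}(-b t ^ α)` turns the equation into `P * u = 0`. -/
lemma eq_zero_of_primitive_eq {α : ℝ} (hα : 1 < α) {b : ℂ} {u : ℝ → ℂ}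
    (hu : ∀ T, IntegrableOn u (Ioc 0 T)) (hc : ContinuousOn u (Ioi 0))
    (h : ∀ t > 0, halfConv (powerKernel 1) u t = -b * halfConv (powerKernel (α + 1)) u t)
    {t : ℝ} (ht : 0 < t) : u t = 0 := by
  have hα0 : 0 < α := by linarith
  have hker := continuous_mlKernel (α := α) (β := α) hα hα.le b
  have hmeas : Measurable (mlKernel α α b) := hker.measurable
  have hP : ∀ τ > 0, halfConv (powerKernel (α + 1)) u τ = 0 := by
    intro τ hτ
    have assoc : ∀ ν, 1 ≤ ν → halfConv (mlKernel α α b) (halfConv (powerKernel ν) u) τ =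
        halfConv (mlKernel α (α + ν) b) u τ := by
      intro ν hν
      obtain ⟨C, hC⟩ := exists_bound_Ioc (continuous_powerKernel hν) τ
      rw [halfConv_assoc_of_bounded hτ hmeas (integrableOn_mlKernel hα hα0 b hτ.le)
        (measurable_powerKernel ν) hC (hu τ)]
      refine halfConv_congr hτ.le (fun s hs _ => ?_) fun _ _ _ => rfl
      rw [halfConv_comm, halfConv_powerKernel_mlKernel hα hα0 (by linarith) b hs]
    have h1 : halfConv (mlKernel α (α + 1) b) u τ =
        -b * halfConv (mlKernel α (α + (α + 1)) b) u τ := by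
      rw [← assoc 1 le_rfl, ← assoc (α + 1) (by linarith), mul_comm, ← halfConv_mul_const]
      refine halfConv_congr hτ.le (fun _ _ _ => rfl) fun s hs _ => ?_
      rw [h s hs, mul_comm]
    have h2 : halfConv (powerKernel (α + 1)) u τ = halfConv (mlKernel α (α + 1) b) u τ +
        halfConv (mlKernel α (α + (α + 1)) b) u τ * b := by
      rw [← halfConv_mul_const]
      unfold halfConv
      rw [← intervalIntegral.integral_add
        (intervalIntegrable_halfConv_of_continuous (continuous_mlKernel hα (by linarith) b) hτ
          (hu τ))
        (intervalIntegrable_halfConv_of_continuous (continuous_mlKernel hα (by linarith) b) hτ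
          ((hu τ).mul_const b)), intervalIntegral.integral_of_le hτ.le,
        intervalIntegral.integral_of_le hτ.le, integral_Ioc_eq_integral_Ioo,
        integral_Ioc_eq_integral_Ioo]
      refine setIntegral_congr_fun measurableSet_Ioo fun s hs => ?_
      rw [mlKernel_eq_sub hα (by linarith : 0 < α + 1) b (sub_pos.2 hs.2),
        show α + 1 + α = α + (α + 1) by ring]
      ring
    rw [h2, h1]; ring
  have h0 : (fun t => ∫ s in (0 : ℝ)..t, u s) =ᶠ[𝓝 t] fun _ => 0 := by
    filter_upwards [Ioi_mem_nhds ht] with τ hτ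
    rw [← halfConv_one, h τ hτ, hP τ hτ, mul_zero]
  exact (hasDerivAt_primitive hu hc ht).unique ((hasDerivAt_const t 0).congr_of_eventuallyEq h0)

/-- The Riemann-Liouville integral of order `α - 1` inverts that of order `2 - α` up to one
integration. -/
lemma halfConv_rlIntegral {α : ℝ} (hα : 1 < α) (hα2 : α ≤ 2) {y : ℝ → ℂ} {t : ℝ} (ht : 0 < t)
    (hy : IntegrableOn y (Ioc 0 t)) :
    halfConv (powerKernel (α - 1)) (rlIntegral (2 - α) y) t = ∫ s in (0 : ℝ)..t, y s := by
  rw [← halfConv_one]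
  rcases hα2.eq_or_lt with rfl | h2
  · have : rlIntegral (2 - 2) y = y := by ext s; simp [rlIntegral]
    rw [this]; norm_num
  · have h3 : rlIntegral (2 - α) y = halfConv (powerKernel (2 - α)) y := by
      ext s; exact rlIntegral_eq_halfConv (by linarith) y s
    have e1 : 0 < α - 1 := by linarith
    have e2 : 0 < 2 - α := by linarith
    rw [h3, halfConv_assoc (M := 1) ht (measurable_powerKernel _) (measurable_powerKernel _) hy
      (fun τ hτ => intervalIntegrable_powerKernel_mul e1 e2 hτ.1) fun τ hτ => ?_]
    · refine halfConv_congr ht.le (fun s hs _ => ?_) fun _ _ _ => rfl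
      rw [halfConv_powerKernel e1 e2 hs]; congr 1; ring
    · rw [integral_norm_powerKernel_mul e1 e2 hτ.1, show α - 1 + (2 - α) = 1 by ring]
      simp

/-! ### The scalar problem for a single frequency -/

/-- The solution `e_α a + e_{α-1} c + e_α * w` of the scalar fractional equation
`D^α v + b v = w` with data `a`, `c`, where `e_β(t) = t ^ (β - 1) E_{α,β}(-b t ^ α)`. -/
def modeSolution (α : ℝ) (b a c : ℂ) (w : ℝ → ℂ) (t : ℝ) : ℂ :=
  mlKernel α α b t * a + mlKernel α (α - 1) b t * c + halfConv (mlKernel α α b) w t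

lemma mlKernel_at_zero {α β : ℝ} (hβ : 1 < β) (b : ℂ) : mlKernel α β b 0 = 0 := by
  rw [mlKernel, Real.zero_rpow (by linarith)]; simp

lemma powerKernel_at_zero {ν : ℝ} (hν : 1 < ν) : powerKernel ν 0 = 0 := by
  rw [powerKernel, Real.zero_rpow (by linarith)]; simp

lemma continuousOn_modeSolution {α : ℝ} (hα : 1 < α) (b a c : ℂ) {w : ℝ → ℂ}
    (hw : ∀ T, IntegrableOn w (Ioc 0 T)) : ContinuousOn (modeSolution α b a c w) (Ioi 0) := by
  unfold modeSolution
  have h1 := continuousOn_mlKernel (β := α) hα (by linarith) b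
  have h2 := continuousOn_mlKernel (β := α - 1) hα (by linarith) b
  have h3 := continuousOn_halfConv (continuous_mlKernel hα hα.le b) (mlKernel_at_zero hα b) hw
  exact ((h1.mul continuousOn_const).add (h2.mul continuousOn_const)).add h3

lemma intervalIntegrable_powerKernel_mlKernel {α β ν : ℝ} (hα : 1 < α) (hβ : 0 < β) (hν : 0 < ν)
    (b : ℂ) {t : ℝ} (ht : 0 < t) :
    IntervalIntegrable (fun s => powerKernel ν (t - s) * mlKernel α β b s) volume 0 t := by
  obtain ⟨C, hC⟩ := exists_norm_mlKernel_le hα hβ b t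
  have hG := Real.Gamma_pos_of_pos hβ
  have h := ((intervalIntegrable_powerKernel_mul hν hβ ht).norm.const_mul (C * Real.Gamma β))
  rw [intervalIntegrable_iff_integrableOn_Ioc_of_le ht.le] at h ⊢
  refine h.mono' (((measurable_powerKernel ν).comp (measurable_const.sub measurable_id)).mul
    (measurable_mlKernel hα hβ measurable_const measurable_id)).aestronglyMeasurable
    ((ae_restrict_iff' measurableSet_Ioc).2 (Eventually.of_forall fun s hs => ?_))
  rw [norm_mul, norm_mul, norm_powerKernel hβ hs.1.le]
  calc _ ≤ ‖powerKernel ν (t - s)‖ * (C * s ^ (β - 1)) :=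
        mul_le_mul_of_nonneg_left (hC s hs) (norm_nonneg _)
    _ = _ := by field_simp

lemma intervalIntegrable_powerKernel_halfConv {α ν : ℝ} (hα : 1 < α) (hν : 0 < ν)
    (b : ℂ) {w : ℝ → ℂ} (hw : ∀ T, IntegrableOn w (Ioc 0 T)) {t : ℝ} (ht : 0 < t) :
    IntervalIntegrable (fun s => powerKernel ν (t - s) * halfConv (mlKernel α α b) w s)
      volume 0 t := by
  obtain ⟨C, -, hC⟩ := exists_norm_halfConv_le (continuous_mlKernel hα hα.le b) t
  refine intervalIntegrable_halfConv ⟨ht, le_rfl⟩ (integrableOn_powerKernel hν ht.le) ?_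
    (hC w (hw t))
  exact ((continuousOn_halfConv (continuous_mlKernel hα hα.le b) (mlKernel_at_zero hα b)
    hw).mono Ioc_subset_Ioi_self).aestronglyMeasurable measurableSet_Ioc

lemma intervalIntegrable_powerKernel_modeSolution {α ν : ℝ} (hα : 1 < α) (hν : 0 < ν)
    (b a c : ℂ) {w : ℝ → ℂ} (hw : ∀ T, IntegrableOn w (Ioc 0 T)) {t : ℝ} (ht : 0 < t) :
    IntervalIntegrable (fun s => powerKernel ν (t - s) * modeSolution α b a c w s)
      volume 0 t := by
  have h1 := (intervalIntegrable_powerKernel_mlKernel (β := α) hα (by linarith) hν b ht).mul_const a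
  have h2 := (intervalIntegrable_powerKernel_mlKernel (β := α - 1) hα (by linarith) hν b
    ht).mul_const c
  have h3 := intervalIntegrable_powerKernel_halfConv hα hν b hw ht
  refine ((h1.add h2).add h3).congr fun s _ => ?_
  simp only [modeSolution]
  ring

lemma integrableOn_modeSolution {α : ℝ} (hα : 1 < α) (b a c : ℂ) {w : ℝ → ℂ}
    (hw : ∀ T, IntegrableOn w (Ioc 0 T)) (T : ℝ) :
    IntegrableOn (modeSolution α b a c w) (Ioc 0 T) := by
  rcases le_or_gt T 0 with hT | hT
  · simp [Ioc_eq_empty (not_lt.2 hT)]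
  have := intervalIntegrable_powerKernel_modeSolution hα one_pos b a c hw hT
  simp only [powerKernel_one, one_mul] at this
  exact (intervalIntegrable_iff_integrableOn_Ioc_of_le hT.le).1 this

lemma rlIntegral_modeSolution {α ν : ℝ} (hα : 1 < α) (hν : 0 ≤ ν) (b a c : ℂ) {w : ℝ → ℂ}
    (hw : ∀ T, IntegrableOn w (Ioc 0 T)) {t : ℝ} (ht : 0 < t) :
    rlIntegral ν (modeSolution α b a c w) t = mlKernel α (α + ν) b t * a +
      mlKernel α (α - 1 + ν) b t * c + halfConv (mlKernel α (α + ν) b) w t := by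
  rcases hν.eq_or_lt with rfl | hν
  · simp [rlIntegral, modeSolution]
  have h1 := intervalIntegrable_powerKernel_mlKernel (β := α) hα (by linarith) hν b ht
  have h2 := intervalIntegrable_powerKernel_mlKernel (β := α - 1) hα (by linarith) hν b ht
  have h3 := intervalIntegrable_powerKernel_halfConv hα hν b hw ht
  have hker := continuous_mlKernel (α := α) (β := α) hα hα.le b
  obtain ⟨C, hC⟩ := exists_bound_Ioc hker t
  have h4 : halfConv (powerKernel ν) (halfConv (mlKernel α α b) w) t =
      halfConv (mlKernel α (α + ν) b) w t := by
    rw [halfConv_assoc_of_bounded ht (measurable_powerKernel ν)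
      (integrableOn_powerKernel hν ht.le) hker.measurable hC (hw t)]
    exact halfConv_congr ht.le (fun s hs _ =>
      halfConv_powerKernel_mlKernel hα (by linarith) hν b hs) fun _ _ _ => rfl
  rw [rlIntegral_eq_halfConv hν.ne', ← h4,
    ← halfConv_powerKernel_mlKernel (β := α) hα (by linarith) hν b ht,
    ← halfConv_powerKernel_mlKernel (β := α - 1) hα (by linarith) hν b ht,
    ← halfConv_mul_const, ← halfConv_mul_const]
  have e1 : IntervalIntegrable (fun s => powerKernel ν (t - s) * (mlKernel α α b s * a))
      volume 0 t := (h1.mul_const a).congr fun s _ => mul_assoc _ _ _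
  have e2 : IntervalIntegrable (fun s => powerKernel ν (t - s) * (mlKernel α (α - 1) b s * c))
      volume 0 t := (h2.mul_const c).congr fun s _ => mul_assoc _ _ _
  rw [← halfConv_add_right e1 e2, ← halfConv_add_right ?_ h3]
  · rfl
  · exact (e1.add e2).congr fun s _ => (mul_add _ _ _).symm

/-- The scalar solution solves the integrated equation, to which any further fractional
integration may have been applied. -/
lemma rlIntegral_modeSolution_eq {α ν : ℝ} (hα : 1 < α) (hν : 0 ≤ ν) (b a c : ℂ) {w : ℝ → ℂ}
    (hw : ∀ T, IntegrableOn w (Ioc 0 T)) {t : ℝ} (ht : 0 < t) :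
    rlIntegral ν (modeSolution α b a c w) t = powerKernel (α - 1 + ν) t * c +
      powerKernel (α + ν) t * a +
      halfConv (powerKernel (α + ν)) (fun s => w s - b * modeSolution α b a c w s) t := by
  have hν' : 0 < α + ν := by linarith
  have h1 := rlIntegral_modeSolution hα hν b a c hw ht
  have h2 := rlIntegral_modeSolution (ν := α + ν) hα hν'.le b a c hw ht
  rw [rlIntegral_eq_halfConv hν'.ne'] at h2
  have hPw := intervalIntegrable_halfConv_of_continuous
    (continuous_powerKernel (by linarith : 1 ≤ α + ν)) ht (hw t)
  have hPV := intervalIntegrable_halfConv_of_continuous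
    (continuous_powerKernel (by linarith : 1 ≤ α + ν)) ht
      (integrableOn_modeSolution hα b a c hw t)
  have h3 : halfConv (powerKernel (α + ν)) (fun s => w s - b * modeSolution α b a c w s) t =
      halfConv (powerKernel (α + ν)) w t -
        b * halfConv (powerKernel (α + ν)) (modeSolution α b a c w) t := by
    unfold halfConv
    rw [← intervalIntegral.integral_const_mul, ← intervalIntegral.integral_sub hPw
      (hPV.const_mul b)]
    refine intervalIntegral.integral_congr fun s _ => ?_
    simp only; ring
  have hew := intervalIntegrable_halfConv_of_continuous
    (continuous_mlKernel hα (by linarith : 1 ≤ α + ν) b) ht (hw t)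
  have hew' := intervalIntegrable_halfConv_of_continuous
    (continuous_mlKernel hα (by linarith : 1 ≤ α + (α + ν)) b) ht (hw t)
  have h4 : halfConv (mlKernel α (α + ν) b) w t = halfConv (powerKernel (α + ν)) w t -
      b * halfConv (mlKernel α (α + (α + ν)) b) w t := by
    unfold halfConv
    rw [← intervalIntegral.integral_const_mul, ← intervalIntegral.integral_sub hPw
      (hew'.const_mul b), intervalIntegral.integral_of_le ht.le,
      intervalIntegral.integral_of_le ht.le, integral_Ioc_eq_integral_Ioo,
      integral_Ioc_eq_integral_Ioo]
    refine setIntegral_congr_fun measurableSet_Ioo fun s hs => ?_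
    rw [mlKernel_eq_sub hα hν' b (sub_pos.2 hs.2), show α + ν + α = α + (α + ν) by ring]
    ring
  rw [h1, h3, h2, h4, mlKernel_eq_sub hα hν' b ht,
    mlKernel_eq_sub hα (by linarith : 0 < α - 1 + ν) b ht,
    show α + ν + α = α + (α + ν) by ring, show α - 1 + ν + α = α - 1 + (α + ν) by ring]
  ring

/-- Uniqueness for the scalar problem in integrated form. -/
lemma eq_modeSolution {α : ℝ} (hα : 1 < α) (b a c : ℂ) {v w : ℝ → ℂ}
    (hw : ∀ T, IntegrableOn w (Ioc 0 T)) (hv : ∀ T, IntegrableOn v (Ioc 0 T))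
    (hc : ContinuousOn v (Ioi 0))
    (h : ∀ t > 0, ∫ s in (0 : ℝ)..t, v s = powerKernel α t * c + powerKernel (α + 1) t * a +
      halfConv (powerKernel (α + 1)) (fun s => w s - b * v s) t)
    {t : ℝ} (ht : 0 < t) : v t = modeSolution α b a c w t := by
  have hV := integrableOn_modeSolution hα b a c hw
  refine sub_eq_zero.1 (eq_zero_of_primitive_eq (u := fun t => v t - modeSolution α b a c w t)
    (b := b) hα (fun T => (hv T).sub (hV T)) (hc.sub (continuousOn_modeSolution hα b a c hw))
    (fun τ hτ => ?_) ht)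
  have hm := rlIntegral_modeSolution_eq hα zero_le_one b a c hw hτ
  rw [rlIntegral_eq_halfConv one_ne_zero, halfConv_one, sub_add_cancel] at hm
  have hP := continuous_powerKernel (by linarith : 1 ≤ α + 1)
  have hint : ∀ y : ℝ → ℂ, (∀ T, IntegrableOn y (Ioc 0 T)) →
      IntervalIntegrable (fun s => powerKernel (α + 1) (τ - s) * (w s - b * y s)) volume 0 τ :=
    fun y hy => intervalIntegrable_halfConv_of_continuous hP hτ ((hw τ).sub ((hy τ).const_mul b))
  rw [halfConv_one, intervalIntegral.integral_sub (intervalIntegrable_of_integrableOn hv hτ.le)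
    (intervalIntegrable_of_integrableOn hV hτ.le), h τ hτ, hm, add_sub_add_left_eq_sub]
  unfold halfConv
  rw [← intervalIntegral.integral_sub (hint v hv) (hint _ hV),
    ← intervalIntegral.integral_const_mul]
  refine intervalIntegral.integral_congr fun s _ => ?_
  simp only; ring

/-! ### The symbols and the transformed solution -/

lemma norm_rfSymbol (γ θ k : ℝ) : ‖rfSymbol γ θ k‖ = |k| ^ γ := by
  rw [rfSymbol, norm_mul, Complex.norm_real,
    Real.norm_of_nonneg (Real.rpow_nonneg (abs_nonneg _) _),
    show Complex.I * (Real.sign k : ℂ) * θ * Real.pi / 2 =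
      ((Real.sign k * θ * Real.pi / 2 : ℝ) : ℂ) * Complex.I by push_cast; ring,
    Complex.norm_exp_ofReal_mul_I, mul_one]

lemma measurable_sign : Measurable Real.sign := by
  unfold Real.sign
  exact Measurable.ite measurableSet_Iio measurable_const
    (Measurable.ite measurableSet_Ioi measurable_const measurable_const)

lemma measurable_rfSymbol (γ θ : ℝ) : Measurable (rfSymbol γ θ) := by
  unfold rfSymbol
  have := measurable_sign
  fun_prop

variable {n : ℕ}

lemma measurable_bSymbol (μ γ θ : Fin n → ℝ) : Measurable (bSymbol μ γ θ) := by
  unfold bSymbol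
  have := fun j => measurable_rfSymbol (γ j) (θ j)
  fun_prop

lemma measurable_weight (γ : Fin n → ℝ) : Measurable (weight γ) := by
  unfold weight
  fun_prop

lemma one_le_weight (γ : Fin n → ℝ) (k : ℝ) : 1 ≤ weight γ k :=
  le_add_of_nonneg_right (Finset.sum_nonneg fun _ _ => Real.rpow_nonneg (abs_nonneg _) _)

lemma weight_ne_zero (γ : Fin n → ℝ) (k : ℝ) : (weight γ k : ℂ) ≠ 0 := by
  exact_mod_cast (zero_lt_one.trans_le (one_le_weight γ k)).ne'

lemma norm_weight (γ : Fin n → ℝ) (k : ℝ) : ‖(weight γ k : ℂ)‖ = weight γ k := by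
  rw [Complex.norm_real, Real.norm_of_nonneg (zero_le_one.trans (one_le_weight γ k))]

lemma norm_rfSymbol_le_weight (γ θ : Fin n → ℝ) (j : Fin n) (k : ℝ) :
    ‖rfSymbol (γ j) (θ j) k‖ ≤ weight γ k := by
  rw [norm_rfSymbol, weight]
  have := Finset.single_le_sum (f := fun j => |k| ^ γ j)
    (fun _ _ => Real.rpow_nonneg (abs_nonneg _) _) (Finset.mem_univ j)
  linarith

lemma norm_bSymbol_le (μ γ θ : Fin n → ℝ) (k : ℝ) :
    ‖bSymbol μ γ θ k‖ ≤ (∑ j, |μ j|) * weight γ k := by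
  rw [bSymbol, Finset.sum_mul]
  refine norm_sum_le_of_le _ fun j _ => ?_
  rw [norm_mul, Complex.norm_real, Real.norm_eq_abs]
  exact mul_le_mul_of_nonneg_left (norm_rfSymbol_le_weight γ θ j k) (abs_nonneg _)

/-- The Fourier transform in space of the solution: for each frequency the solution of the scalar
fractional equation with the transformed data. -/
def transformedSolution (α : ℝ) (μ γ θ : Fin n → ℝ) (f g : ℝ → ℂ) (φ : ℝ → ℝ → ℂ)
    (k t : ℝ) : ℂ :=
  modeSolution α (bSymbol μ γ θ k) (fourierT f k) (fourierT g k) (sourceT φ k) t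

lemma integrableOn_source_reflected {α : ℝ} {μ γ θ : Fin n → ℝ} {f g : ℝ → ℂ}
    {φ : ℝ → ℝ → ℂ} (hconv : FormulaConverges α μ γ θ f g φ) {t : ℝ} (ht : 0 < t) :
    IntegrableOn (fun p : ℝ × ℝ => mlKernel α α (bSymbol μ γ θ p.1) (t - p.2) *
      sourceT φ p.1 p.2) (univ ×ˢ Ioc 0 t) := by
  let e : ℝ × ℝ ≃ᵐ ℝ × ℝ := (MeasurableEquiv.refl ℝ).prodCongr (MeasurableEquiv.subLeft t)
  have he : MeasurePreserving e volume volume :=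
    (MeasurePreserving.id volume).prod (volume.measurePreserving_sub_left t)
  have h := (he.integrableOn_comp_preimage e.measurableEmbedding).2 (hconv.φ_term t ht)
  have hpre : e ⁻¹' (univ ×ˢ Ioo 0 t) = univ ×ˢ Ioo 0 t := by
    ext p
    change (p.1 ∈ univ ∧ t - p.2 ∈ Ioo 0 t) ↔ (p.1 ∈ univ ∧ p.2 ∈ Ioo 0 t)
    simp only [mem_univ, mem_Ioo, true_and, sub_pos, sub_lt_self_iff]
    exact and_comm
  rw [hpre, IntegrableOn, volume_restrict_univ_prod] at h
  rw [IntegrableOn, volume_restrict_univ_prod,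
    ← Measure.restrict_congr_set Ioo_ae_eq_Ioc]
  refine h.congr (Eventually.of_forall fun p => ?_)
  change (((t - p.2) ^ (α - 1) : ℝ) : ℂ) * mittagLeffler α α (-bSymbol μ γ θ p.1 *
    (((t - p.2) ^ α : ℝ) : ℂ)) * sourceT φ p.1 (t - (t - p.2)) = _
  rw [sub_sub_cancel]
  rfl

lemma integrable_mlKernel_mul {α β : ℝ} {b u : ℝ → ℂ} {t : ℝ}
    (h : Integrable fun k => mittagLeffler α β (-b k * ((t ^ α : ℝ) : ℂ)) * u k) :
    Integrable fun k => mlKernel α β (b k) t * u k := by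
  refine (h.const_mul ((t ^ (β - 1) : ℝ) : ℂ)).congr (Eventually.of_forall fun k => ?_)
  simp only [mlKernel, mul_assoc]

lemma invFourierT_mlKernel_mul (α β : ℝ) (b u : ℝ → ℂ) (t x : ℝ) :
    invFourierT (fun k => mlKernel α β (b k) t * u k) x =
      ((t ^ (β - 1) / √(2 * Real.pi) : ℝ) : ℂ) * ∫ k : ℝ, Complex.exp (-(Complex.I * k * x)) *
        mittagLeffler α β (-b k * ((t ^ α : ℝ) : ℂ)) * u k := by
  have : (fun k => mlKernel α β (b k) t * u k) = fun k => ((t ^ (β - 1) : ℝ) : ℂ) *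
      (mittagLeffler α β (-b k * ((t ^ α : ℝ) : ℂ)) * u k) := by
    ext k; rw [mlKernel, mul_assoc]
  rw [this, invFourierT_const_mul, invFourierT, ← mul_assoc]
  congr 1
  · push_cast; rw [div_eq_mul_inv]
  · simp only [mul_assoc]

lemma integrable_transformedSolution {α : ℝ} {μ γ θ : Fin n → ℝ} {f g : ℝ → ℂ}
    {φ : ℝ → ℝ → ℂ} (hconv : FormulaConverges α μ γ θ f g φ) {t : ℝ} (ht : 0 < t) :
    Integrable fun k => transformedSolution α μ γ θ f g φ k t := by
  have h3 := integrable_integral_slab (H := fun k s => mlKernel α α (bSymbol μ γ θ k) (t - s) *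
      sourceT φ k s) ht.le (integrableOn_source_reflected hconv ht)
  exact ((integrable_mlKernel_mul (hconv.f_term t ht)).add
    (integrable_mlKernel_mul (hconv.g_term t ht))).add h3

/-- The solution formula is the inverse Fourier integral of the transformed solution. -/
lemma solutionFormula_eq {α : ℝ} {μ γ θ : Fin n → ℝ} {f g : ℝ → ℂ}
    {φ : ℝ → ℝ → ℂ} (hconv : FormulaConverges α μ γ θ f g φ) (x : ℝ) {t : ℝ} (ht : 0 < t) :
    solutionFormula α μ γ θ f g φ x t =
      invFourierT (fun k => transformedSolution α μ γ θ f g φ k t) x := by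
  have hH := integrableOn_source_reflected hconv ht
  have h1 := integrable_mlKernel_mul (hconv.f_term t ht)
  have h2 := integrable_mlKernel_mul (hconv.g_term t ht)
  have h3 := integrable_integral_slab (H := fun k s => mlKernel α α (bSymbol μ γ θ k) (t - s) *
      sourceT φ k s) ht.le hH
  have e := invFourierT_add_add h1 h2 h3 x
  rw [← integral_invFourierT (H := fun k s => mlKernel α α (bSymbol μ γ θ k) (t - s) *
      sourceT φ k s) ht.le hH, invFourierT_mlKernel_mul, invFourierT_mlKernel_mul,
      show α - 1 - 1 = α - 2 by ring] at e
  unfold transformedSolution modeSolution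
  refine Eq.trans ?_ e.symm
  rw [solutionFormula]
  congr 1
  have hsub := intervalIntegral.integral_comp_sub_left (a := 0) (b := t)
    (fun ξ => ((ξ ^ (α - 1) : ℝ) : ℂ) * ∫ k : ℝ, mittagLeffler α α (-bSymbol μ γ θ k *
      ((ξ ^ α : ℝ) : ℂ)) * Complex.exp (-(Complex.I * k * x)) * sourceT φ k (t - ξ)) t
  simp only [sub_self, sub_zero, sub_sub_cancel] at hsub
  rw [← hsub, ← intervalIntegral.integral_const_mul]
  refine intervalIntegral.integral_congr fun s _ => ?_
  rw [invFourierT, ← integral_const_mul]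
  congr 2
  ext k
  rw [mlKernel]
  ring

/-! ### Riemann-Liouville derivatives of order `α - 2`, `α - 1` and `α` -/

lemma rlDeriv_sub_two {α : ℝ} (hα2 : α ≤ 2) (y : ℝ → ℂ) :
    rlDeriv (α - 2) y = rlIntegral (2 - α) y := by
  have h : ⌈α - 2⌉₊ = 0 := Nat.ceil_eq_zero.2 (by linarith)
  ext t
  rw [rlDeriv, h, iteratedDeriv_zero]
  congr 1; push_cast; ring

lemma rlDeriv_sub_one {α : ℝ} (hα : 1 < α) (hα2 : α ≤ 2) (y : ℝ → ℂ) :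
    rlDeriv (α - 1) y = deriv (rlIntegral (2 - α) y) := by
  have h : ⌈α - 1⌉₊ = 1 := by
    rw [Nat.ceil_eq_iff one_ne_zero]
    constructor <;> norm_num <;> linarith
  ext t
  rw [rlDeriv, h, iteratedDeriv_one]
  congr 2; push_cast; ring

lemma rlDeriv_eq {α : ℝ} (hα : 1 < α) (hα2 : α ≤ 2) (y : ℝ → ℂ) :
    rlDeriv α y = deriv (deriv (rlIntegral (2 - α) y)) := by
  have h : ⌈α⌉₊ = 2 := by
    rw [Nat.ceil_eq_iff two_ne_zero]
    constructor <;> norm_num <;> linarith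
  ext t
  rw [rlDeriv, h, iteratedDeriv_succ, iteratedDeriv_one]
  norm_num

lemma halfConv_two {w : ℝ → ℂ} (hw : ∀ T, IntegrableOn w (Ioc 0 T)) {t : ℝ} (ht : 0 < t) :
    halfConv (powerKernel 2) w t = ∫ s in (0 : ℝ)..t, ∫ r in (0 : ℝ)..s, w r := by
  have h := halfConv_assoc_of_bounded (C := 1) ht (measurable_powerKernel 1)
    (integrableOn_powerKernel one_pos ht.le) (measurable_powerKernel 1)
    (fun s _ => by rw [powerKernel_one, norm_one]) (hw t)
  rw [halfConv_one] at h
  simp only [halfConv_one] at h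
  rw [h]
  refine halfConv_congr ht.le (fun s hs _ => ?_) fun _ _ _ => rfl
  rw [powerKernel_two, halfConv_one]
  simp [powerKernel_one]

/-- Taylor's formula at the singular endpoint `0`. -/
lemma eq_taylor {W Φ : ℝ → ℂ} {a c : ℂ} (hW : DifferentiableOn ℝ W (Ioi 0))
    (hW' : DifferentiableOn ℝ (deriv W) (Ioi 0)) (hΦ : ∀ t > 0, deriv (deriv W) t = Φ t)
    (hint : ∀ T, IntegrableOn Φ (Ioc 0 T)) (ha : Tendsto (deriv W) (𝓝[>] 0) (𝓝 a))
    (hc : Tendsto W (𝓝[>] 0) (𝓝 c)) {t : ℝ} (ht : 0 < t) :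
    W t = c + t * a + halfConv (powerKernel 2) Φ t := by
  have hd : ∀ s > 0, HasDerivAt W (deriv W s) s := fun s hs =>
    (hW.differentiableAt (Ioi_mem_nhds hs)).hasDerivAt
  have hd' : ∀ s > 0, HasDerivAt (deriv W) (Φ s) s := fun s hs => by
    rw [← hΦ s hs]; exact (hW'.differentiableAt (Ioi_mem_nhds hs)).hasDerivAt
  have h1 : ∀ s > 0, deriv W s = a + ∫ r in (0 : ℝ)..s, Φ r := fun s hs => by
    rw [intervalIntegral.integral_eq_sub_of_hasDerivAt_of_tendsto hs
      (fun r hr => hd' r hr.1) (intervalIntegrable_of_integrableOn hint hs.le) ha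
      ((hd' s hs).continuousAt.tendsto.mono_left nhdsWithin_le_nhds)]
    ring
  have hprim : Continuous fun s => ∫ r in (0 : ℝ)..s, (Ioi (0 : ℝ)).indicator Φ r := by
    refine intervalIntegral.continuous_primitive (fun p q => ?_) 0
    rw [intervalIntegrable_iff]
    refine (integrable_indicator_iff measurableSet_Ioi).2 ?_
    rw [IntegrableOn, Measure.restrict_restrict measurableSet_Ioi]
    refine (hint (max p q)).mono_set fun r hr => ⟨hr.1, hr.2.2⟩
  have h2 : ∀ s > 0, ∫ r in (0 : ℝ)..s, (Ioi (0 : ℝ)).indicator Φ r =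
      ∫ r in (0 : ℝ)..s, Φ r := fun s hs => by
    rw [intervalIntegral.integral_of_le hs.le, intervalIntegral.integral_of_le hs.le]
    exact setIntegral_congr_fun measurableSet_Ioc fun r hr => indicator_of_mem hr.1 Φ
  have hii : IntervalIntegrable (fun s => ∫ r in (0 : ℝ)..s, Φ r) volume 0 t := by
    refine (hprim.intervalIntegrable 0 t).congr fun s hs => ?_
    rw [uIoc_of_le ht.le] at hs
    exact h2 s hs.1
  have h3 := intervalIntegral.integral_eq_sub_of_hasDerivAt_of_tendsto ht
    (f := W) (f' := fun s => a + ∫ r in (0 : ℝ)..s, Φ r)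
    (fun r hr => by rw [← h1 r hr.1]; exact hd r hr.1)
    (intervalIntegrable_const.add hii) hc
    ((hd t ht).continuousAt.tendsto.mono_left nhdsWithin_le_nhds)
  rw [intervalIntegral.integral_add intervalIntegrable_const hii,
    intervalIntegral.integral_const, sub_zero, Complex.real_smul, ← halfConv_two hint ht] at h3
  linear_combination -h3

/-- A Taylor formula for `₀I^{2-α} y`, fractionally integrated to order one. -/
lemma integral_eq_of_taylor {α : ℝ} (hα : 1 < α) (hα2 : α ≤ 2) {y Φ : ℝ → ℂ} {a c : ℂ}
    (hy : ∀ T, IntegrableOn y (Ioc 0 T)) (hΦ : ∀ T, IntegrableOn Φ (Ioc 0 T))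
    (h : ∀ t > 0, rlIntegral (2 - α) y t = c + t * a + halfConv (powerKernel 2) Φ t)
    {t : ℝ} (ht : 0 < t) :
    ∫ s in (0 : ℝ)..t, y s = powerKernel α t * c + powerKernel (α + 1) t * a +
      halfConv (powerKernel (α + 1)) Φ t := by
  have h0 : 0 < α - 1 := by linarith
  rw [← halfConv_rlIntegral hα hα2 ht (hy t)]
  have hP : Continuous (powerKernel 2) := continuous_powerKernel one_le_two
  have e1 := (intervalIntegrable_powerKernel_mul h0 one_pos ht).mul_const c
  have e2 := (intervalIntegrable_powerKernel_mul h0 two_pos ht).mul_const a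
  simp only [mul_assoc] at e1 e2
  obtain ⟨C, -, hC⟩ := exists_norm_halfConv_le hP t
  have e3 : IntervalIntegrable (fun s => powerKernel (α - 1) (t - s) *
      halfConv (powerKernel 2) Φ s) volume 0 t := by
    refine intervalIntegrable_halfConv ⟨ht, le_rfl⟩ (integrableOn_powerKernel h0 ht.le) ?_
      (hC Φ (hΦ t))
    exact ((continuousOn_halfConv hP (powerKernel_at_zero one_lt_two) hΦ).mono
      Ioc_subset_Ioi_self).aestronglyMeasurable measurableSet_Ioc
  have hcongr : halfConv (powerKernel (α - 1)) (rlIntegral (2 - α) y) t =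
      halfConv (powerKernel (α - 1)) (fun s => powerKernel 1 s * c + powerKernel 2 s * a +
        halfConv (powerKernel 2) Φ s) t :=
    halfConv_congr ht.le (fun _ _ _ => rfl) fun s hs _ => by
      rw [h s hs, powerKernel_one, powerKernel_two, one_mul]
  obtain ⟨C', hC'⟩ := exists_bound_Ioc hP t
  rw [hcongr, halfConv_add_right ((e1.add e2).congr fun s _ => (mul_add _ _ _).symm) e3,
    halfConv_add_right e1 e2, halfConv_mul_const, halfConv_mul_const,
    halfConv_powerKernel h0 one_pos ht, halfConv_powerKernel h0 two_pos ht,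
    halfConv_assoc_of_bounded ht (measurable_powerKernel _)
      (integrableOn_powerKernel h0 ht.le) hP.measurable hC' (hΦ t), sub_add_cancel,
    show α - 1 + 2 = α + 1 by ring]
  congr 1
  refine halfConv_congr ht.le (fun s hs _ => ?_) fun _ _ _ => rfl
  rw [halfConv_powerKernel h0 two_pos hs, show α - 1 + 2 = α + 1 by ring]

/-! ### Uniqueness -/

lemma eqOn_Ioi_of_rat {u v : ℝ → ℂ} (hu : ContinuousOn u (Ioi 0)) (hv : ContinuousOn v (Ioi 0))
    (h : ∀ q : ℚ, (0 : ℝ) < q → u q = v q) {t : ℝ} (ht : 0 < t) : u t = v t := by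
  by_contra hne
  have ho : IsOpen (Ioi (0 : ℝ) ∩ (fun t => u t - v t) ⁻¹' {0}ᶜ) :=
    (hu.sub hv).isOpen_inter_preimage isOpen_Ioi isOpen_compl_singleton
  obtain ⟨q, hq, hq'⟩ := Rat.denseRange_cast.exists_mem_open ho ⟨t, ht, sub_ne_zero.2 hne⟩
  exact hq' (sub_eq_zero.2 (h q hq))

/-- Convolution in time commutes with the inverse Fourier integral. -/
lemma halfConv_invFourierT {p : ℝ → ℂ} {H : ℝ → ℝ → ℂ} {t : ℝ} (ht : 0 ≤ t)
    (hH : IntegrableOn (fun z : ℝ × ℝ => p (t - z.2) * H z.1 z.2) (univ ×ˢ Ioc 0 t)) (x : ℝ) :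
    halfConv p (fun s => invFourierT (fun k => H k s) x) t =
      invFourierT (fun k => halfConv p (H k) t) x := by
  unfold halfConv
  rw [← integral_invFourierT (H := fun k s => p (t - s) * H k s) ht hH]
  refine intervalIntegral.integral_congr fun s _ => ?_
  simp only
  rw [invFourierT_const_mul]

lemma integrableOn_slab_kernel {p : ℝ → ℂ} (hp : Continuous p) {H : ℝ → ℝ → ℂ} {t : ℝ}
    (hH : IntegrableOn (fun z : ℝ × ℝ => H z.1 z.2) (univ ×ˢ Ioc 0 t)) :
    IntegrableOn (fun z : ℝ × ℝ => p (t - z.2) * H z.1 z.2) (univ ×ˢ Ioc 0 t) := by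
  obtain ⟨C, hC⟩ := (isCompact_Icc (a := (0 : ℝ)) (b := t)).exists_bound_of_continuousOn
    hp.continuousOn
  refine Integrable.bdd_mul (c := C) hH
    (by fun_prop : Continuous fun z : ℝ × ℝ => p (t - z.2)).aestronglyMeasurable ?_
  refine (ae_restrict_iff' (MeasurableSet.univ.prod measurableSet_Ioc)).2
    (Eventually.of_forall fun z hz => hC _ ⟨?_, ?_⟩)
  · linarith [hz.2.2]
  · linarith [hz.2.1]

lemma integrableOn_slab_bdd_mul {c : ℝ → ℂ} (hc : Measurable c) {C : ℝ} (hC : ∀ k, ‖c k‖ ≤ C)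
    {H : ℝ → ℝ → ℂ} {S : Set (ℝ × ℝ)} (hH : IntegrableOn (fun z : ℝ × ℝ => H z.1 z.2) S) :
    IntegrableOn (fun z : ℝ × ℝ => c z.1 * H z.1 z.2) S :=
  Integrable.bdd_mul hH (hc.comp measurable_fst).aestronglyMeasurable
    (Eventually.of_forall fun z => hC z.1)

lemma norm_div_weight_le {γ : Fin n → ℝ} {c : ℝ → ℂ} {C : ℝ}
    (hC : ∀ k, ‖c k‖ ≤ C * weight γ k) (k : ℝ) : ‖c k / weight γ k‖ ≤ C := by
  rw [norm_div, norm_weight, div_le_iff₀ (zero_lt_one.trans_le (one_le_weight γ k))]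
  exact hC k

/-- Absolute convergence of the formula forces every solution to be given by it. -/
theorem eq_solutionFormula {α : ℝ} {μ γ θ : Fin n → ℝ} (hα : 1 < α) (hα2 : α ≤ 2)
    {f g : ℝ → ℂ} {φ : ℝ → ℝ → ℂ} (hdata : IsData f g φ)
    (hconv : FormulaConverges α μ γ θ f g φ) {N : ℝ → ℝ → ℂ}
    (hN : IsSolution α μ γ θ f g φ N) (x : ℝ) {t : ℝ} (ht : 0 < t) :
    N x t = solutionFormula α μ γ θ f g φ x t := by
  obtain ⟨V, hV, hVc, hVw⟩ := hN.transformable.exists_transform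
  obtain ⟨D, hD, hEq⟩ := hN.equation
  set b := bSymbol μ γ θ with hb
  -- products of `V` with symbols dominated by the weight are integrable on slabs
  have hslab : ∀ c : ℝ → ℂ, Measurable c → ∀ C : ℝ, (∀ k, ‖c k‖ ≤ C * weight γ k) → ∀ T > 0,
      IntegrableOn (fun p : ℝ × ℝ => c p.1 * V p.1 p.2) (univ ×ˢ Ioc 0 T) := by
    intro c hc C hC T hT
    have hm : Measurable fun k => c k / (weight γ k : ℂ) :=
      hc.div (Complex.measurable_ofReal.comp (measurable_weight γ))
    refine (integrableOn_slab_bdd_mul (H := fun k s => (weight γ k : ℂ) * V k s) hm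
      (norm_div_weight_le hC) (hVw T hT)).congr (Eventually.of_forall fun p => ?_)
    have := weight_ne_zero γ p.1
    simp only
    field_simp
  have hVs : ∀ T > 0, IntegrableOn (fun p : ℝ × ℝ => V p.1 p.2) (univ ×ˢ Ioc 0 T) := by
    intro T hT
    have := hslab (fun _ => 1) measurable_const 1
      (fun k => by rw [norm_one, one_mul]; exact one_le_weight γ k) T hT
    simpa using this
  let F : ℝ → ℝ → ℂ := fun k s => sourceT φ k s - b k * V k s
  have hFs : ∀ T > 0, IntegrableOn (fun p : ℝ × ℝ => F p.1 p.2) (univ ×ˢ Ioc 0 T) :=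
    fun T hT => (hdata.φ_integrable T hT).sub
      (hslab b (measurable_bSymbol μ γ θ) _ (norm_bSymbol_le μ γ θ) T hT)
  -- the spatial derivatives, expressed through `V`
  have hDV : ∀ j, ∀ s > 0, Integrable (fun k => rfSymbol (γ j) (θ j) k * V k s) ∧
      ∀ x, D j x s = -invFourierT (fun k => rfSymbol (γ j) (θ j) k * V k s) x := by
    intro j s hs
    obtain ⟨v, hv, hv'⟩ := hD j s hs
    have hae : v =ᵐ[volume] fun k => V k s :=
      ae_eq_of_invFourierT hv.1 (hV s hs).1 fun x => by rw [← hv.2 x, ← (hV s hs).2 x]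
    have hae' : (fun k => -rfSymbol (γ j) (θ j) k * v k) =ᵐ[volume]
        fun k => (-1) * (rfSymbol (γ j) (θ j) k * V k s) := by
      filter_upwards [hae] with k hk
      rw [hk]; ring
    refine ⟨?_, fun x => ?_⟩
    · have := (hv'.1.congr hae').const_mul (-1)
      refine this.congr (Eventually.of_forall fun k => ?_)
      simp only; ring
    · rw [show D j x s = _ from hv'.2 x, invFourierT_congr_ae hae', invFourierT_const_mul, neg_one_mul]
  have hbV : ∀ s, (fun k => b k * V k s) =
      fun k => ∑ j, (μ j : ℂ) * (rfSymbol (γ j) (θ j) k * V k s) := by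
    intro s; ext k
    rw [hb, bSymbol, Finset.sum_mul]
    exact Finset.sum_congr rfl fun j _ => mul_assoc _ _ _
  have hΦ : ∀ x, ∀ s > 0, rlDeriv α (N x) s = invFourierT (fun k => F k s) x := by
    intro x s hs
    have hi : ∀ j, Integrable fun k => (μ j : ℂ) * (rfSymbol (γ j) (θ j) k * V k s) :=
      fun j => (hDV j s hs).1.const_mul _
    have hib : Integrable fun k => b k * V k s := by
      rw [hbV s]; exact integrable_finsetSum _ fun j _ => hi j
    have hφ := (hdata.φ_inv s hs).isFourierTransform
    have e1 := invFourierT_sub hφ.1 hib x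
    rw [← hφ.2 x, hbV s, invFourierT_sum _ fun j _ => hi j] at e1
    simp only [fun k => congrFun (hbV s) k] at e1
    have e2 : (fun k => F k s) = fun k => fourierT (fun x => φ x s) k -
        ∑ j, (μ j : ℂ) * (rfSymbol (γ j) (θ j) k * V k s) := by
      ext k
      rw [← congrFun (hbV s) k]; rfl
    rw [hEq x s hs, e2, e1, sub_eq_neg_add, ← Finset.sum_neg_distrib]
    congr 1
    refine Finset.sum_congr rfl fun j _ => ?_
    rw [(hDV j s hs).2 x, invFourierT_const_mul]; ring
  have pos_of : ∀ {y : ℝ → ℂ}, (∀ T > 0, IntegrableOn y (Ioc 0 T)) →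
      ∀ T, IntegrableOn y (Ioc 0 T) := by
    intro y hy T
    rcases le_or_gt T 0 with hT | hT
    · simp [Ioc_eq_empty (not_lt.2 hT)]
    · exact hy T hT
  -- the integrated equation in space
  have hspace : ∀ x, ∀ s > 0, ∫ r in (0 : ℝ)..s, N x r =
      powerKernel α s * g x + powerKernel (α + 1) s * f x +
        halfConv (powerKernel (α + 1)) (fun r => invFourierT (fun k => F k r) x) s := by
    intro x s hs
    have hΦi : ∀ T, IntegrableOn (fun r => invFourierT (fun k => F k r) x) (Ioc 0 T) :=
      pos_of fun T hT => integrableOn_invFourierT (hFs T hT) x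
    refine integral_eq_of_taylor hα hα2 (pos_of (hN.transformable.integrableOn x)) hΦi
      (fun r hr => ?_) hs
    have d2 := hN.differentiableOn₂ x
    have d1 := hN.differentiableOn₁ x
    have i1 := hN.initial₁ x
    have i2 := hN.initial₂ x
    rw [rlDeriv_sub_two hα2] at d2 i2
    rw [rlDeriv_sub_one hα hα2] at d1 i1
    refine eq_taylor d2 d1 (fun τ hτ => ?_) hΦi i1 i2 hr
    rw [← rlDeriv_eq hα hα2, hΦ x τ hτ]
  -- the integrated equation for each frequency, first for a fixed time
  have hP : Continuous (powerKernel (α + 1)) := continuous_powerKernel (by linarith)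
  have hfreq : ∀ s > 0, ∀ᵐ k : ℝ, ∫ r in (0 : ℝ)..s, V k r =
      powerKernel α s * fourierT g k + powerKernel (α + 1) s * fourierT f k +
        halfConv (powerKernel (α + 1)) (F k) s := by
    intro s hs
    have hf := hdata.f_inv.isFourierTransform
    have hg := hdata.g_inv.isFourierTransform
    have hK := integrableOn_slab_kernel hP (hFs s hs)
    have hKi : Integrable fun k => halfConv (powerKernel (α + 1)) (F k) s :=
      integrable_integral_slab (H := fun k r => powerKernel (α + 1) (s - r) * F k r) hs.le hK
    have h1 := hg.1.const_mul (powerKernel α s)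
    have h2 := hf.1.const_mul (powerKernel (α + 1) s)
    refine ae_eq_of_invFourierT (integrable_integral_slab hs.le (hVs s hs))
      ((h1.add h2).add hKi) fun x => ?_
    refine Eq.trans ?_ (invFourierT_add_add h1 h2 hKi x).symm
    rw [invFourierT_const_mul, invFourierT_const_mul, ← hg.2 x, ← hf.2 x,
      ← integral_invFourierT hs.le (hVs s hs), ← halfConv_invFourierT hs.le hK, ← hspace x s hs,
      intervalIntegral.integral_of_le hs.le, intervalIntegral.integral_of_le hs.le]
    exact setIntegral_congr_fun measurableSet_Ioc fun r hr => ((hV r hr.1).2 x).symm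
  have hrat : ∀ᵐ k : ℝ, ∀ q : ℚ, (0 : ℝ) < q → ∫ r in (0 : ℝ)..q, V k r =
      powerKernel α q * fourierT g k + powerKernel (α + 1) q * fourierT f k +
        halfConv (powerKernel (α + 1)) (F k) q := by
    refine ae_all_iff.2 fun q => ?_
    by_cases hq : (0 : ℝ) < q
    · filter_upwards [hfreq q hq] with k hk _ using hk
    · exact Eventually.of_forall fun k h => absurd h hq
  have hVk := ae_integrableOn_slab hVs
  have hφk := ae_integrableOn_slab hdata.φ_integrable
  have hae : (fun k => V k t) =ᵐ[volume] fun k => transformedSolution α μ γ θ f g φ k t := by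
    filter_upwards [hrat, hVk, hφk, hVc] with k hk hVi hφi hVcont
    have hFi : ∀ T, IntegrableOn (F k) (Ioc 0 T) := fun T =>
      (hφi T).sub ((hVi T).const_mul (b k))
    refine eq_modeSolution hα (b k) (fourierT f k) (fourierT g k) hφi hVi hVcont
      (fun s hs => ?_) ht
    refine eqOn_Ioi_of_rat (u := fun s => ∫ r in (0 : ℝ)..s, V k r)
      (v := fun s => powerKernel α s * fourierT g k + powerKernel (α + 1) s * fourierT f k +
        halfConv (powerKernel (α + 1)) (F k) s) ?_ ?_ hk hs
    · exact fun s hs => (hasDerivAt_primitive hVi hVcont hs).continuousAt.continuousWithinAt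
    · have h1 := (continuous_powerKernel hα.le).continuousOn (s := Ioi 0)
      exact ((h1.mul continuousOn_const).add (hP.continuousOn.mul continuousOn_const)).add
        (continuousOn_halfConv hP (powerKernel_at_zero (by linarith)) hFi)
  rw [solutionFormula_eq hconv x ht, show N x t = _ from (hV t ht).2 x,
    invFourierT_congr_ae hae]

/-! ### Families dominated by an integrable time singularity -/

/-- A family `H(k, t)`, `t > 0`, measurable, continuous in `t`, and bounded on each `(0, T]` by
`t ^ (α - 2) G(k)` with an integrable `G`. The transformed solution and its products with the
symbols are of this kind; the exponent is the singularity at `t = 0` caused by the datum `g`. -/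
structure SingularlyDominated (α : ℝ) (H : ℝ → ℝ → ℂ) : Prop where
  aestronglyMeasurable : ∀ t > 0, AEStronglyMeasurable fun k => H k t
  aestronglyMeasurable_slab : ∀ T > 0, AEStronglyMeasurable (fun p : ℝ × ℝ => H p.1 p.2)
    (volume.restrict (univ ×ˢ Ioc 0 T))
  continuousOn : ∀ᵐ k : ℝ, ContinuousOn (H k) (Ioi 0)
  dominated : ∀ T > 0, ∃ G : ℝ → ℝ, Integrable G ∧
    ∀ᵐ k : ℝ, ∀ t ∈ Ioc 0 T, ‖H k t‖ ≤ t ^ (α - 2) * G k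

namespace SingularlyDominated

variable {α : ℝ} {H H' : ℝ → ℝ → ℂ}

lemma sub (hH : SingularlyDominated α H) (hH' : SingularlyDominated α H') :
    SingularlyDominated α fun k t => H k t - H' k t where
  aestronglyMeasurable t ht := (hH.1 t ht).sub (hH'.1 t ht)
  aestronglyMeasurable_slab T hT := (hH.2 T hT).sub (hH'.2 T hT)
  continuousOn := by
    filter_upwards [hH.continuousOn, hH'.continuousOn] with k h h' using h.sub h'
  dominated T hT := by
    obtain ⟨G, hG, h⟩ := hH.dominated T hT
    obtain ⟨G', hG', h'⟩ := hH'.dominated T hT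
    refine ⟨fun k => G k + G' k, hG.add hG', ?_⟩
    filter_upwards [h, h'] with k h h' t ht
    rw [mul_add]
    exact (norm_sub_le _ _).trans (add_le_add (h t ht) (h' t ht))

lemma bdd_mul (hH : SingularlyDominated α H) {c : ℝ → ℂ} (hc : Measurable c) {C : ℝ}
    (hC : ∀ k, ‖c k‖ ≤ C) : SingularlyDominated α fun k t => c k * H k t where
  aestronglyMeasurable t ht := hc.aestronglyMeasurable.mul (hH.1 t ht)
  aestronglyMeasurable_slab T hT :=
    (hc.comp measurable_fst).aestronglyMeasurable.mul (hH.2 T hT)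
  continuousOn := by
    filter_upwards [hH.continuousOn] with k h using continuousOn_const.mul h
  dominated T hT := by
    obtain ⟨G, hG, h⟩ := hH.dominated T hT
    refine ⟨fun k => C * G k, hG.const_mul C, ?_⟩
    filter_upwards [h] with k h t ht
    rw [norm_mul, mul_left_comm]
    exact mul_le_mul (hC k) (h t ht) (norm_nonneg _) ((norm_nonneg _).trans (hC k))

lemma integrable (hH : SingularlyDominated α H) {t : ℝ} (ht : 0 < t) :
    Integrable fun k => H k t := by
  obtain ⟨G, hG, h⟩ := hH.dominated t ht
  refine (hG.const_mul (t ^ (α - 2))).mono' (hH.1 t ht) ?_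
  filter_upwards [h] with k h using h t ⟨ht, le_rfl⟩

/-- Integrability on slabs, even after multiplication by a kernel that is integrable against the
singularity `t ^ (α - 2)`. -/
lemma integrableOn_kernel_mul (hH : SingularlyDominated α H) {t : ℝ} (ht : 0 < t) {p : ℝ → ℂ}
    (hp : Measurable p) (hpi : IntegrableOn (fun s => ‖p s‖ * s ^ (α - 2)) (Ioc 0 t)) :
    IntegrableOn (fun z : ℝ × ℝ => p z.2 * H z.1 z.2) (univ ×ˢ Ioc 0 t) := by
  obtain ⟨G, hG, h⟩ := hH.dominated t ht
  have hm := hH.2 t ht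
  have hae := ae_slab_of_ae measurableSet_Ioc h
  have hb := Integrable.mul_prod hG hpi
  rw [← volume_restrict_univ_prod] at hb
  refine hb.mono' ((hp.comp measurable_snd).aestronglyMeasurable.mul hm) ?_
  filter_upwards [hae] with z hz
  rw [norm_mul]
  calc ‖p z.2‖ * ‖H z.1 z.2‖ ≤ ‖p z.2‖ * (z.2 ^ (α - 2) * G z.1) :=
        mul_le_mul_of_nonneg_left hz (norm_nonneg _)
    _ = _ := by ring

lemma integrableOn (hH : SingularlyDominated α H) (hα : 1 < α) {T : ℝ} (hT : 0 < T) :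
    IntegrableOn (fun z : ℝ × ℝ => H z.1 z.2) (univ ×ˢ Ioc 0 T) := by
  have := integrableOn_rpow (ν := α - 1) (by linarith) hT.le
  rw [show α - 1 - 1 = α - 2 by ring] at this
  simpa using hH.integrableOn_kernel_mul hT (measurable_const (a := (1 : ℂ))) (by simpa using this)

lemma continuousOn_invFourierT (hH : SingularlyDominated α H) (x : ℝ) :
    ContinuousOn (fun t => invFourierT (fun k => H k t) x) (Ioi 0) := by
  intro t₀ ht₀
  rw [mem_Ioi] at ht₀
  refine ContinuousAt.continuousWithinAt ?_
  obtain ⟨G, hG, h⟩ := hH.dominated (t₀ + 1) (by linarith)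
  have hcr : ContinuousAt (fun t : ℝ => t ^ (α - 2)) t₀ :=
    Real.continuousAt_rpow_const _ _ (Or.inl ht₀.ne')
  have hev : ∀ᶠ t in 𝓝 t₀, t ^ (α - 2) < t₀ ^ (α - 2) + 1 :=
    hcr.eventually_lt continuousAt_const (by linarith)
  have hev' : ∀ᶠ t in 𝓝 t₀, t ∈ Ioc 0 (t₀ + 1) := Ioc_mem_nhds ht₀ (by linarith)
  have hGnn : ∀ᵐ k : ℝ, 0 ≤ G k := by
    filter_upwards [h] with k hk
    have h1 := (norm_nonneg _).trans (hk t₀ ⟨ht₀, by linarith⟩)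
    exact nonneg_of_mul_nonneg_right h1 (Real.rpow_pos_of_pos ht₀ _)
  unfold invFourierT
  refine continuousAt_const.mul (continuousAt_of_dominated
    (bound := fun k => (t₀ ^ (α - 2) + 1) * G k) ?_ ?_ (hG.const_mul _) ?_)
  · filter_upwards [hev'] with t ht
    exact (integrable_exp_mul (hH.integrable ht.1) measurable_id x).1
  · filter_upwards [hev, hev'] with t ht ht'
    filter_upwards [h, hGnn] with k hk hGk
    rw [norm_exp_mul]
    exact (hk t ht').trans (mul_le_mul_of_nonneg_right ht.le hGk)
  · filter_upwards [hH.continuousOn] with k hk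
    exact continuousAt_const.mul (hk.continuousAt (Ioi_mem_nhds ht₀))

lemma integrableOn_invFourierT (hH : SingularlyDominated α H) (hα : 1 < α) (x T : ℝ) :
    IntegrableOn (fun t => invFourierT (fun k => H k t) x) (Ioc 0 T) := by
  rcases le_or_gt T 0 with hT | hT
  · simp [Ioc_eq_empty (not_lt.2 hT)]
  · exact ReactionDiffusion.integrableOn_invFourierT (hH.integrableOn hα hT) x

/-- The Riemann-Liouville integral of order `2 - α` commutes with the inverse Fourier integral. -/
lemma rlIntegral_invFourierT (hH : SingularlyDominated α H) (hα : 1 < α) (hα2 : α ≤ 2) (x : ℝ)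
    {t : ℝ} (ht : 0 < t) :
    rlIntegral (2 - α) (fun s => invFourierT (fun k => H k s) x) t =
      invFourierT (fun k => rlIntegral (2 - α) (H k) t) x := by
  rcases hα2.eq_or_lt with rfl | h2
  · simp [rlIntegral]
  have e1 : 0 < α - 1 := by linarith
  have e2 : 0 < 2 - α := by linarith
  simp only [rlIntegral_eq_halfConv e2.ne']
  refine halfConv_invFourierT ht.le (hH.integrableOn_kernel_mul ht
    ((measurable_powerKernel _).comp (measurable_const.sub measurable_id)) ?_) x
  have hG := Real.Gamma_pos_of_pos e1
  have h := (intervalIntegrable_iff_integrableOn_Ioc_of_le ht.le).1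
    ((intervalIntegrable_powerKernel_mul e2 e1 ht).norm.const_mul (Real.Gamma (α - 1)))
  refine h.congr_fun (fun s hs => ?_) measurableSet_Ioc
  simp only [Function.comp_apply, norm_mul, Pi.sub_apply, id]
  rw [norm_powerKernel e1 hs.1.le, show α - 1 - 1 = α - 2 by ring]
  field_simp

end SingularlyDominated

/-! ### Regularity of the transformed solution -/

variable {α : ℝ} {μ γ θ : Fin n → ℝ} {f g : ℝ → ℂ} {φ : ℝ → ℝ → ℂ}

lemma FormulaConvergesStrongly.formulaConverges (hα : 1 < α) (hdata : IsData f g φ)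
    (h : FormulaConvergesStrongly α μ γ θ f g φ) : FormulaConverges α μ γ θ f g φ := by
  have hb := measurable_bSymbol μ γ θ
  have hE : Measurable (mittagLeffler α α) :=
    (continuous_mittagLeffler hα (by linarith)).measurable
  have hE' : Measurable (mittagLeffler α (α - 1)) :=
    (continuous_mittagLeffler hα (by linarith)).measurable
  have hle : ∀ (k : ℝ) (z : ℂ), ‖z‖ ≤ weight γ k * ‖z‖ := fun k z =>
    le_mul_of_one_le_left (norm_nonneg _) (one_le_weight γ k)
  refine ⟨fun t ht => ?_, fun t ht => ?_, fun t ht => ?_⟩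
  · obtain ⟨G, hG, hd⟩ := h.dominated t ht
    refine hG.mono' (AEStronglyMeasurable.mul
      (hE.comp (by fun_prop)).aestronglyMeasurable
      (continuous_fourierT hdata.f_inv.integrable).aestronglyMeasurable) ?_
    filter_upwards [hd] with k hk
    exact (hle k _).trans (hk t ⟨ht, le_rfl⟩).1
  · obtain ⟨G, hG, hd⟩ := h.dominated t ht
    refine hG.mono' (AEStronglyMeasurable.mul
      (hE'.comp (by fun_prop)).aestronglyMeasurable
      (continuous_fourierT hdata.g_inv.integrable).aestronglyMeasurable) ?_
    filter_upwards [hd] with k hk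
    exact (hle k _).trans (hk t ⟨ht, le_rfl⟩).2.1
  · obtain ⟨G, hG, hd⟩ := h.dominated t ht
    let e : ℝ × ℝ ≃ᵐ ℝ × ℝ := (MeasurableEquiv.refl ℝ).prodCongr (MeasurableEquiv.subLeft t)
    have he : MeasurePreserving e volume volume :=
      (MeasurePreserving.id volume).prod (volume.measurePreserving_sub_left t)
    have hφ := (he.integrableOn_comp_preimage e.measurableEmbedding).2 (hdata.φ_integrable t ht)
    have hφ' : AEStronglyMeasurable (fun p : ℝ × ℝ => sourceT φ p.1 (t - p.2))
        (volume.restrict (univ ×ˢ Ioo 0 t)) := by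
      refine hφ.aestronglyMeasurable.mono_measure (Measure.restrict_mono ?_ le_rfl)
      rintro p ⟨-, hp⟩
      exact ⟨trivial, sub_pos.2 hp.2, sub_le_self _ hp.1.le⟩
    have hr : IntegrableOn (fun s : ℝ => s ^ (α - 1)) (Ioo 0 t) :=
      (integrableOn_rpow (by linarith) ht.le).mono_set Ioo_subset_Ioc_self
    have hbound := Integrable.mul_prod hG hr
    rw [← volume_restrict_univ_prod] at hbound
    refine hbound.mono' (AEStronglyMeasurable.mul ?_ hφ') ?_
    · refine Measurable.aestronglyMeasurable (Measurable.mul (by fun_prop) (hE.comp ?_))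
      fun_prop
    · have hae := ae_slab_of_ae (S := Ioo 0 t) measurableSet_Ioo
        (P := fun k ξ => ξ ∈ Ioo 0 t → ‖mittagLeffler α α (-bSymbol μ γ θ k * ((ξ ^ α : ℝ) : ℂ)) *
          sourceT φ k (t - ξ)‖ ≤ G k) (by
          filter_upwards [hd] with k hk ξ hξ _
          exact (hle k _).trans ((hk ξ ⟨hξ.1, hξ.2.le⟩).2.2 (t - ξ)
            ⟨sub_pos.2 hξ.2, sub_le_self _ hξ.1.le⟩))
      filter_upwards [hae, ae_restrict_mem (MeasurableSet.univ.prod measurableSet_Ioo)] with p hp hp'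
      rw [mul_assoc, norm_mul, Complex.norm_real,
        Real.norm_of_nonneg (Real.rpow_nonneg hp'.2.1.le _), mul_comm]
      exact mul_le_mul_of_nonneg_right (hp hp'.2) (Real.rpow_nonneg hp'.2.1.le _)

lemma one_le_rpow_mul (hα2 : α ≤ 2) {t T : ℝ} (ht : t ∈ Ioc 0 T) :
    1 ≤ t ^ (α - 2) * T ^ (2 - α) := by
  rw [show α - 2 = -(2 - α) by ring, Real.rpow_neg ht.1.le, inv_mul_eq_div,
    one_le_div (Real.rpow_pos_of_pos ht.1 _)]
  exact Real.rpow_le_rpow ht.1.le ht.2 (by linarith)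

lemma singularlyDominated_source (hα : 1 < α) (hα2 : α ≤ 2) (hdata : IsData f g φ)
    (h : FormulaConvergesStrongly α μ γ θ f g φ) : SingularlyDominated α (sourceT φ) where
  aestronglyMeasurable t ht :=
    (continuous_fourierT (hdata.φ_inv t ht).integrable).aestronglyMeasurable
  aestronglyMeasurable_slab T hT := (hdata.φ_integrable T hT).aestronglyMeasurable
  continuousOn := h.φ_continuous
  dominated T hT := by
    obtain ⟨G, hG, hd⟩ := h.dominated T hT
    have hΓ := Real.Gamma_pos_of_pos (zero_lt_one.trans hα)
    refine ⟨fun k => T ^ (2 - α) * Real.Gamma α * G k, hG.const_mul _, ?_⟩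
    filter_upwards [hd] with k hk s hs
    -- the limit `t → 0` in the bound for `E_{α,α}(-b t ^ α) φ*`
    have hlim : Tendsto (fun t : ℝ => ‖mittagLeffler α α
        (-bSymbol μ γ θ k * ((t ^ α : ℝ) : ℂ)) * sourceT φ k s‖) (𝓝[>] 0)
        (𝓝 ((Real.Gamma α)⁻¹ * ‖sourceT φ k s‖)) := by
      have hc : Continuous fun t : ℝ => ‖mittagLeffler α α
          (-bSymbol μ γ θ k * ((t ^ α : ℝ) : ℂ)) * sourceT φ k s‖ := by
        have h1 : Continuous fun t : ℝ => t ^ α := Real.continuous_rpow_const (by linarith)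
        have h2 := continuous_mittagLeffler (α := α) (β := α) hα (by linarith)
        fun_prop
      have h3 := (hc.tendsto 0).mono_left (nhdsWithin_le_nhds (s := Ioi 0))
      rwa [Real.zero_rpow (by linarith), Complex.ofReal_zero, mul_zero, mittagLeffler_zero,
        norm_mul, norm_inv, Complex.norm_real, Real.norm_of_nonneg hΓ.le] at h3
    have hle : (Real.Gamma α)⁻¹ * ‖sourceT φ k s‖ ≤ G k := by
      refine le_of_tendsto hlim ?_
      filter_upwards [Ioc_mem_nhdsGT hT] with t ht
      exact (le_mul_of_one_le_left (norm_nonneg _) (one_le_weight γ k)).trans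
        ((hk t ht).2.2 s hs)
    rw [inv_mul_le_iff₀ hΓ] at hle
    calc ‖sourceT φ k s‖ ≤ 1 * (Real.Gamma α * G k) := by rwa [one_mul]
      _ ≤ (s ^ (α - 2) * T ^ (2 - α)) * (Real.Gamma α * G k) :=
        mul_le_mul_of_nonneg_right (one_le_rpow_mul hα2 hs) ((norm_nonneg _).trans hle)
      _ = _ := by ring

lemma aestronglyMeasurable_halfConv_source (hα : 1 < α) (hdata : IsData f g φ) {T : ℝ}
    (hT : 0 < T) :
    AEStronglyMeasurable (fun p : ℝ × ℝ =>
      halfConv (mlKernel α α (bSymbol μ γ θ p.1)) (sourceT φ p.1) p.2)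
      (volume.restrict (univ ×ˢ Ioc 0 T)) := by
  have hb := measurable_bSymbol μ γ θ
  have hφ := (hdata.φ_integrable T hT).aestronglyMeasurable
  rw [volume_restrict_univ_prod] at hφ ⊢
  set ν := volume.restrict (Ioc (0 : ℝ) T) with hν
  let q : (ℝ × ℝ) × ℝ → ℂ := {z : (ℝ × ℝ) × ℝ | z.2 < z.1.2}.indicator
    fun z => mlKernel α α (bSymbol μ γ θ z.1.1) (z.1.2 - z.2) * sourceT φ z.1.1 z.2
  have hq : AEStronglyMeasurable q (((volume : Measure ℝ).prod ν).prod ν) := by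
    refine AEStronglyMeasurable.indicator (AEStronglyMeasurable.mul ?_ ?_)
      (measurableSet_lt (by fun_prop) (by fun_prop))
    · exact (measurable_mlKernel hα (by linarith) (by fun_prop)
        (by fun_prop)).aestronglyMeasurable
    · exact hφ.comp_quasiMeasurePreserving (QuasiMeasurePreserving.prodMap
        (Measure.quasiMeasurePreserving_fst (μ := (volume : Measure ℝ)) (ν := ν))
        (Measure.QuasiMeasurePreserving.id ν))
  refine hq.integral_prod_right'.congr ?_
  have hmem : ∀ᵐ p : ℝ × ℝ ∂((volume : Measure ℝ).prod ν), p.2 ∈ Ioc 0 T :=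
    Measure.quasiMeasurePreserving_snd.ae (ae_restrict_mem measurableSet_Ioc)
  filter_upwards [hmem] with p hp
  have hsec : ∀ s, q (p, s) = (Iio p.2).indicator (fun s =>
      mlKernel α α (bSymbol μ γ θ p.1) (p.2 - s) * sourceT φ p.1 s) s := by
    intro s
    simp only [q, indicator, mem_ofPred_eq, mem_Iio]
  have hint : Ioc 0 T ∩ Iio p.2 = Ioo 0 p.2 := by
    ext s; simp only [mem_inter_iff, mem_Ioc, mem_Iio, mem_Ioo]
    exact ⟨fun h => ⟨h.1.1, h.2⟩, fun h => ⟨⟨h.1, h.2.le.trans hp.2⟩, h.2⟩⟩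
  simp only [hsec]
  rw [integral_indicator measurableSet_Iio, hν, Measure.restrict_restrict measurableSet_Iio,
    inter_comm, hint, halfConv, intervalIntegral.integral_of_le hp.1.le,
    integral_Ioc_eq_integral_Ioo]

lemma norm_weight_halfConv_le (hα : 1 < α) {k t G : ℝ} (ht : 0 < t)
    (h : ∀ ξ ∈ Ioc 0 t, ∀ s ∈ Ioc 0 t, weight γ k * ‖mittagLeffler α α
      (-bSymbol μ γ θ k * ((ξ ^ α : ℝ) : ℂ)) * sourceT φ k s‖ ≤ G) :
    weight γ k * ‖halfConv (mlKernel α α (bSymbol μ γ θ k)) (sourceT φ k) t‖ ≤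
      t ^ (α - 1) * G * t := by
  have hw := zero_lt_one.trans_le (one_le_weight γ k)
  have hG : 0 ≤ G := (mul_nonneg hw.le (norm_nonneg _)).trans (h t ⟨ht, le_rfl⟩ t ⟨ht, le_rfl⟩)
  rw [← norm_weight γ k, ← norm_mul, halfConv, ← intervalIntegral.integral_const_mul,
    intervalIntegral.integral_of_le ht.le, integral_Ioc_eq_integral_Ioo]
  have := norm_setIntegral_le_of_norm_le_const (μ := volume) (s := Ioo 0 t)
    (f := fun s => (weight γ k : ℂ) * (mlKernel α α (bSymbol μ γ θ k) (t - s) * sourceT φ k s))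
    (C := t ^ (α - 1) * G) (by simp) fun s hs => ?_
  · simpa [ht.le] using this
  · have hts : t - s ∈ Ioc 0 t := ⟨sub_pos.2 hs.2, sub_le_self _ hs.1.le⟩
    rw [mlKernel, mul_assoc, mul_left_comm, norm_mul, Complex.norm_real,
      Real.norm_of_nonneg (Real.rpow_nonneg hts.1.le _), norm_mul, norm_weight]
    exact mul_le_mul (Real.rpow_le_rpow hts.1.le hts.2 (by linarith))
      (h _ hts s ⟨hs.1, hs.2.le⟩) (mul_nonneg hw.le (norm_nonneg _)) (Real.rpow_nonneg ht.le _)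

lemma singularlyDominated_weight_mul (hα : 1 < α) (hdata : IsData f g φ)
    (h : FormulaConvergesStrongly α μ γ θ f g φ) :
    SingularlyDominated α fun k t =>
      (weight γ k : ℂ) * transformedSolution α μ γ θ f g φ k t where
  aestronglyMeasurable t ht := by
    have := (integrable_transformedSolution (h.formulaConverges hα hdata) ht).aestronglyMeasurable
    exact (Complex.measurable_ofReal.comp (measurable_weight γ)).aestronglyMeasurable.mul this
  aestronglyMeasurable_slab T hT := by
    have hb := measurable_bSymbol μ γ θ
    have hw := measurable_weight γ
    have hf := (continuous_fourierT hdata.f_inv.integrable).measurable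
    have hg := (continuous_fourierT hdata.g_inv.integrable).measurable
    have h1 := (measurable_mlKernel (β := α) hα (by linarith) (hb.comp measurable_fst)
      (measurable_snd (α := ℝ) (β := ℝ))).mul (hf.comp measurable_fst)
    have h2 := (measurable_mlKernel (β := α - 1) hα (by linarith) (hb.comp measurable_fst)
      (measurable_snd (α := ℝ) (β := ℝ))).mul (hg.comp measurable_fst)
    exact (Complex.measurable_ofReal.comp (hw.comp measurable_fst)).aestronglyMeasurable.mul
      ((h1.add h2).aestronglyMeasurable.add (aestronglyMeasurable_halfConv_source hα hdata hT))
  continuousOn := by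
    filter_upwards [ae_integrableOn_slab hdata.φ_integrable] with k hk
    exact continuousOn_const.mul (continuousOn_modeSolution hα _ _ _ hk)
  dominated T hT := by
    obtain ⟨G, hG, hd⟩ := h.dominated T hT
    refine ⟨fun k => (T + 1 + T * T) * G k, hG.const_mul _, ?_⟩
    filter_upwards [hd] with k hk t ht
    have hw := zero_lt_one.trans_le (one_le_weight γ k)
    obtain ⟨hf, hg, -⟩ := hk t ht
    have hs := norm_weight_halfConv_le (μ := μ) (θ := θ) hα ht.1 (φ := φ) (G := G k)
      fun ξ hξ s hs => (hk ξ ⟨hξ.1, hξ.2.trans ht.2⟩).2.2 s ⟨hs.1, hs.2.trans ht.2⟩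
    have hG0 : 0 ≤ G k := (mul_nonneg hw.le (norm_nonneg _)).trans hf
    have e1 : t ^ (α - 1) = t ^ (α - 2) * t := by
      rw [← Real.rpow_add_one ht.1.ne']; congr 1; ring
    have hp1 := Real.rpow_nonneg ht.1.le (α - 1)
    have hp2 := Real.rpow_nonneg ht.1.le (α - 2)
    have hf' : weight γ k * ‖mlKernel α α (bSymbol μ γ θ k) t * fourierT f k‖ ≤
        t ^ (α - 1) * G k := by
      rw [mlKernel, mul_assoc, norm_mul, Complex.norm_real, Real.norm_of_nonneg hp1,
        mul_left_comm]
      exact mul_le_mul_of_nonneg_left hf hp1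
    have hg' : weight γ k * ‖mlKernel α (α - 1) (bSymbol μ γ θ k) t * fourierT g k‖ ≤
        t ^ (α - 2) * G k := by
      rw [mlKernel, mul_assoc, norm_mul, show α - 1 - 1 = α - 2 by ring, Complex.norm_real,
        Real.norm_of_nonneg hp2, mul_left_comm]
      exact mul_le_mul_of_nonneg_left hg hp2
    rw [norm_mul, norm_weight]
    calc weight γ k * ‖transformedSolution α μ γ θ f g φ k t‖
        ≤ t ^ (α - 1) * G k + t ^ (α - 2) * G k + t ^ (α - 1) * G k * t := by
          refine (mul_le_mul_of_nonneg_left (norm_add₃_le) hw.le).trans ?_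
          rw [mul_add, mul_add]
          exact add_le_add (add_le_add hf' hg') hs
      _ = t ^ (α - 2) * G k * (t + 1 + t * t) := by rw [e1]; ring
      _ ≤ t ^ (α - 2) * G k * (T + 1 + T * T) := by
          refine mul_le_mul_of_nonneg_left ?_ (mul_nonneg hp2 hG0)
          have := mul_le_mul ht.2 ht.2 ht.1.le hT.le
          linarith [ht.2]
      _ = _ := by ring

lemma singularlyDominated_symbol_mul (hα : 1 < α) (hdata : IsData f g φ)
    (h : FormulaConvergesStrongly α μ γ θ f g φ) {c : ℝ → ℂ} (hc : Measurable c) {C : ℝ}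
    (hC : ∀ k, ‖c k‖ ≤ C * weight γ k) :
    SingularlyDominated α fun k t => c k * transformedSolution α μ γ θ f g φ k t := by
  have hm : Measurable fun k => c k / (weight γ k : ℂ) :=
    hc.div (Complex.measurable_ofReal.comp (measurable_weight γ))
  have := (singularlyDominated_weight_mul hα hdata h).bdd_mul hm (norm_div_weight_le hC)
  have e : (fun k t => c k / (weight γ k : ℂ) *
      ((weight γ k : ℂ) * transformedSolution α μ γ θ f g φ k t)) =
      fun k t => c k * transformedSolution α μ γ θ f g φ k t := by
    ext k t
    have := weight_ne_zero γ k
    field_simp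
  rwa [e] at this

/-! ### The formula is a solution -/

/-- A function with `₀I^{2-α} y = c + t a + ∫₀ᵗ ∫₀ˢ Φ` has the Riemann-Liouville derivatives that
this representation suggests. -/
lemma rlDeriv_of_taylor (hα : 1 < α) (hα2 : α ≤ 2) {y Φ : ℝ → ℂ} {a c : ℂ}
    (hΦ : ∀ T, IntegrableOn Φ (Ioc 0 T)) (hΦc : ContinuousOn Φ (Ioi 0))
    (h : ∀ t > 0, rlIntegral (2 - α) y t = c + t * a + halfConv (powerKernel 2) Φ t) :
    DifferentiableOn ℝ (rlDeriv (α - 2) y) (Ioi 0) ∧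
    DifferentiableOn ℝ (rlDeriv (α - 1) y) (Ioi 0) ∧
    (∀ t > 0, rlDeriv α y t = Φ t) ∧
    Tendsto (rlDeriv (α - 1) y) (𝓝[>] 0) (𝓝 a) ∧
    Tendsto (rlDeriv (α - 2) y) (𝓝[>] 0) (𝓝 c) := by
  set P : ℝ → ℂ := fun t => ∫ s in (0 : ℝ)..t, Φ s with hP
  have hPd : ∀ t > 0, HasDerivAt P (Φ t) t := fun t ht => hasDerivAt_primitive hΦ hΦc ht
  have hPc : ContinuousOn P (Ioi 0) := fun t ht => (hPd t ht).continuousAt.continuousWithinAt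
  have hPi : ∀ T, IntegrableOn P (Ioc 0 T) := by
    intro T
    have h1 := intervalIntegral.continuousOn_primitive (a := 0) (b := T)
      ((integrableOn_Icc_iff_integrableOn_Ioc).2 (hΦ T))
    refine ((h1.integrableOn_Icc).mono_set Ioc_subset_Icc_self).congr_fun (fun t ht => ?_)
      measurableSet_Ioc
    simp only [hP]
    rw [intervalIntegral.integral_of_le ht.1.le]
  have hW : ∀ t > 0, rlIntegral (2 - α) y t = c + t * a + ∫ s in (0 : ℝ)..t, P s :=
    fun t ht => by rw [h t ht, halfConv_two hΦ ht]
  have hd : ∀ t > 0, HasDerivAt (rlIntegral (2 - α) y) (a + P t) t := by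
    intro t ht
    have h1 : HasDerivAt (fun t : ℝ => c + (t : ℂ) * a + ∫ s in (0 : ℝ)..t, P s)
        (1 * a + P t) t :=
      (((Complex.ofRealCLM.hasDerivAt (x := t)).mul_const a).const_add c).add
        (hasDerivAt_primitive hPi hPc ht)
    rw [one_mul] at h1
    refine h1.congr_of_eventuallyEq ?_
    filter_upwards [Ioi_mem_nhds ht] with s hs using hW s hs
  have hd' : ∀ t > 0, HasDerivAt (deriv (rlIntegral (2 - α) y)) (Φ t) t := by
    intro t ht
    refine ((hPd t ht).const_add a).congr_of_eventuallyEq ?_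
    filter_upwards [Ioi_mem_nhds ht] with s hs using (hd s hs).deriv
  rw [rlDeriv_sub_two hα2, rlDeriv_sub_one hα hα2, rlDeriv_eq hα hα2]
  refine ⟨fun t ht => (hd t ht).differentiableAt.differentiableWithinAt,
    fun t ht => (hd' t ht).differentiableAt.differentiableWithinAt,
    fun t ht => (hd' t ht).deriv, ?_, ?_⟩
  · have h1 := (tendsto_primitive hΦ).const_add a
    rw [add_zero] at h1
    refine h1.congr' ?_
    filter_upwards [self_mem_nhdsWithin] with t ht using ((hd t ht).deriv).symm
  · have h0 : Tendsto (fun t : ℝ => c + (t : ℂ) * a) (𝓝[>] 0) (𝓝 c) := by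
      have hc : Continuous fun t : ℝ => c + (t : ℂ) * a := by fun_prop
      have := (hc.tendsto 0).mono_left (nhdsWithin_le_nhds (s := Ioi 0))
      simpa using this
    have h1 := h0.add (tendsto_primitive hPi)
    rw [add_zero] at h1
    refine h1.congr' ?_
    filter_upwards [self_mem_nhdsWithin] with t ht using (hW t ht).symm

/-- Under strong convergence the formula defines a solution. -/
theorem isSolution_solutionFormula (hα : 1 < α) (hα2 : α ≤ 2) (hdata : IsData f g φ)
    (h : FormulaConvergesStrongly α μ γ θ f g φ) :
    IsSolution α μ γ θ f g φ (solutionFormula α μ γ θ f g φ) := by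
  have hconv := h.formulaConverges hα hdata
  set b := bSymbol μ γ θ with hb
  set V := transformedSolution α μ γ θ f g φ with hV
  set N := solutionFormula α μ γ θ f g φ with hNdef
  have hN : ∀ x, ∀ t > 0, N x t = invFourierT (fun k => V k t) x :=
    fun x t ht => solutionFormula_eq hconv x ht
  have hVdom : SingularlyDominated α V := by
    simpa using singularlyDominated_symbol_mul hα hdata h (measurable_const (a := (1 : ℂ)))
      (C := 1) fun k => by rw [norm_one, one_mul]; exact one_le_weight γ k
  have hbV : SingularlyDominated α fun k t => b k * V k t :=
    singularlyDominated_symbol_mul hα hdata h (measurable_bSymbol μ γ θ) (norm_bSymbol_le μ γ θ)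
  have hrV : ∀ j, SingularlyDominated α fun k t => -rfSymbol (γ j) (θ j) k * V k t := fun j =>
    singularlyDominated_symbol_mul hα hdata h (measurable_rfSymbol _ _).neg
      (C := 1) fun k => by rw [norm_neg, one_mul]; exact norm_rfSymbol_le_weight γ θ j k
  have hφ := singularlyDominated_source hα hα2 hdata h
  let F : ℝ → ℝ → ℂ := fun k t => sourceT φ k t - b k * V k t
  have hF : SingularlyDominated α F := hφ.sub hbV
  -- the integrated equation in space
  have hspace : ∀ x, ∀ t > 0, rlIntegral (2 - α) (N x) t = g x + t * f x +
      halfConv (powerKernel 2) (fun s => invFourierT (fun k => F k s) x) t := by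
    intro x t ht
    have hf := hdata.f_inv.isFourierTransform
    have hg := hdata.g_inv.isFourierTransform
    have hNV : rlIntegral (2 - α) (N x) t =
        rlIntegral (2 - α) (fun s => invFourierT (fun k => V k s) x) t := by
      rcases hα2.eq_or_lt with h2 | h2
      · simp [rlIntegral, h2, hN x t ht]
      · rw [rlIntegral_eq_halfConv (by linarith), rlIntegral_eq_halfConv (by linarith)]
        exact halfConv_congr ht.le (fun _ _ _ => rfl) fun s hs _ => hN x s hs
    have hK := integrableOn_slab_kernel (continuous_powerKernel one_le_two)
      (hF.integrableOn hα ht)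
    have hKi : Integrable fun k => halfConv (powerKernel 2) (F k) t :=
      integrable_integral_slab (H := fun k r => powerKernel 2 (t - r) * F k r) ht.le hK
    have hae : (fun k => rlIntegral (2 - α) (V k) t) =ᵐ[volume] fun k =>
        fourierT g k + (t : ℂ) * fourierT f k + halfConv (powerKernel 2) (F k) t := by
      filter_upwards [ae_integrableOn_slab hdata.φ_integrable] with k hk
      have := rlIntegral_modeSolution_eq (ν := 2 - α) hα (by linarith) (b k) (fourierT f k)
        (fourierT g k) hk ht
      rw [show α - 1 + (2 - α) = 1 by ring, show α + (2 - α) = 2 by ring, powerKernel_one,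
        powerKernel_two, one_mul] at this
      exact this
    rw [hNV, hVdom.rlIntegral_invFourierT hα hα2 x ht, invFourierT_congr_ae hae,
      invFourierT_add_add hg.1 (hf.1.const_mul _) hKi, invFourierT_const_mul, ← hg.2 x,
      ← hf.2 x, halfConv_invFourierT ht.le hK]
  have htaylor := fun x => rlDeriv_of_taylor hα hα2 (hF.integrableOn_invFourierT hα x)
    (hF.continuousOn_invFourierT x) (hspace x)
  have htrans : ∀ t > 0, IsFourierTransform (fun x => N x t) fun k => V k t :=
    fun t ht => ⟨hVdom.integrable ht, fun x => hN x t ht⟩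
  have hdecay : ∀ t > 0, Tendsto (fun x => N x t) (cocompact ℝ) (𝓝 0) := fun t ht =>
    (tendsto_invFourierT fun k => V k t).congr fun x => (hN x t ht).symm
  refine ⟨⟨fun x => ?_, fun x T hT => ?_, V, htrans, hVdom.continuousOn, fun T hT => ?_⟩,
    fun x => (htaylor x).1, fun x => (htaylor x).2.1,
    ⟨fun j x t => invFourierT (fun k => -rfSymbol (γ j) (θ j) k * V k t) x,
      fun j t ht => ⟨fun k => V k t, htrans t ht, (hrV j).integrable ht, fun x => rfl⟩,
      fun x t ht => ?_⟩,
    fun x => (htaylor x).2.2.2.1, fun x => (htaylor x).2.2.2.2,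
    fun t ht => (hdecay t ht).mono_left atTop_le_cocompact,
    fun t ht => (hdecay t ht).mono_left atBot_le_cocompact⟩
  · exact (hVdom.continuousOn_invFourierT x).congr fun t ht => hN x t ht
  · exact (hVdom.integrableOn_invFourierT hα x T).congr_fun (fun t ht => (hN x t ht.1).symm)
      measurableSet_Ioc
  · exact (singularlyDominated_weight_mul hα hdata h).integrableOn hα hT
  · rw [(htaylor x).2.2.1 t ht]
    have hφ' := (hdata.φ_inv t ht).isFourierTransform
    have hi : ∀ j, Integrable fun k => (μ j : ℂ) * (-rfSymbol (γ j) (θ j) k * V k t) := fun j =>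
      ((hrV j).integrable ht).const_mul _
    have hsum : (fun k => F k t) = fun k =>
        (∑ j, (μ j : ℂ) * (-rfSymbol (γ j) (θ j) k * V k t)) + fourierT (fun x => φ x t) k := by
      ext k
      simp only [F, hb, bSymbol, sourceT, Finset.sum_mul]
      rw [sub_eq_neg_add, ← Finset.sum_neg_distrib]
      congr 1
      exact Finset.sum_congr rfl fun j _ => by ring
    rw [hsum, invFourierT_add (integrable_finsetSum _ fun j _ => hi j) hφ'.1, ← hφ'.2 x,
      invFourierT_sum _ fun j _ => hi j]
    congr 1
    exact Finset.sum_congr rfl fun j _ => invFourierT_const_mul _ _ _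

end

end ReactionDiffusion

theorem theorem1 {n : ℕ} (α : ℝ) (μ γ θ : Fin n → ℝ)
    (hα : 1 < α ∧ α ≤ 2)
    (hμ : ∀ j, 0 < μ j)
    (hγ : ∀ j, 0 < γ j ∧ γ j ≤ 2)
    (hθ : ∀ j, |θ j| ≤ min (γ j) (2 - γ j))
    (f g : ℝ → ℂ) (φ : ℝ → ℝ → ℂ)
    (hdata : ReactionDiffusion.IsData f g φ) :
    (ReactionDiffusion.FormulaConverges α μ γ θ f g φ →
      ∀ N : ℝ → ℝ → ℂ, ReactionDiffusion.IsSolution α μ γ θ f g φ N →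
        ∀ x t : ℝ, 0 < t → N x t = ReactionDiffusion.solutionFormula α μ γ θ f g φ x t) ∧
    (ReactionDiffusion.FormulaConvergesStrongly α μ γ θ f g φ →
      ReactionDiffusion.IsSolution α μ γ θ f g φ
        (ReactionDiffusion.solutionFormula α μ γ θ f g φ)) := by
  exact ⟨fun hconv _ hN x _ ht =>
      ReactionDiffusion.eq_solutionFormula hα.1 hα.2 hdata hconv hN x ht,
    fun h => ReactionDiffusion.isSolution_solutionFormula hα.1 hα.2 hdata h⟩
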